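/- **Setting.** Let $L\ge 3$ and $A,B\ge 0$ be integers, $0<\lambda<1$, and $\sigma^2,\gamma_p,\theta_p,\theta_s>0$. A single-antenna primary link has channel $h_p\sim\mathcal{CN}(0,1)$ and gain $g_p=|h_p|^2$. A secondary transmitter with $L$ antennas has channel $\mathbf h_x\in\mathbb C^L$ to the primary receiver, with i.i.d. $\mathcal{CN}(0,\lambda)$ entries, and channel $\mathbf h_s\in\mathbb C^L$ to the (single-antenna) secondary receiver, with i.i.d. $\mathcal{CN}(0,1)$ entries. The three channels are independent. Put $g_x=\|\mathbf h_x\|^2/\lambda$, $g_s=\|\mathbf h_s\|^2$, $\mathbf s_x=\mathbf h_x/\|\mathbf h_x\|$, $\mathbf s_s=\mathbf h_s/\|\mathbf h_s\|$. *CDI feedback.* The unit vector $\hat{\mathbf s}_x$ is obtained from $\mathbf s_x$ by a $B$-bit quantizer, modelled as a (possibly randomized) function of $\mathbf s_x$ whose private randomness is independent of the three channels and whose error $\epsilon=1-|\hat{\mathbf s}_x^\dagger\mathbf s_x|^2$ satisfies $\Pr(\epsilon\le\tau)=2^B\tau^{L-1}$ for $0\le\tau\le 2^{-B/(L-1)}$.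 *IPC feedback (without feedforward).* Let $P_{\max}>0$ be the maximum secondary transmit power, $\omega=\sigma^2(\gamma_pg_p/\theta_p-1)$, and let $\eta=\omega/(\lambda g_x\epsilon)$ if $\omega\ge0$, $\eta=P_{\max}$ otherwise. Let $N=2^A$ and let $\mathcal P=\{p_0<\dots<p_{N-1}\}$ be the equal-probability codebook: $p_0=0$, $\Pr(p_n<\eta\le p_{n+1}\mid\gamma_pg_p\ge\theta_p)=1/N$ for $0\le n\le N-2$, and $\Pr(\eta>p_{N-1}\mid\gamma_pg_p\ge\theta_p)=1/N$. The quantized signal is $\hat\eta=\max\{p\in\mathcal P:p\le\eta\}$ if $\omega\ge0$ and $\eta<P_{\max}$, and $\hat\eta=P_{\max}$ otherwise. *Orthogonal cognitive beamforming (OCB).* The beamformer $\mathbf f$ maximizes $|\mathbf f^\dagger\mathbf s_s|^2$ subject to $\mathbf f^\dagger\hat{\mathbf s}_x=0$ and $\|\mathbf f\|^2\le\hat\eta$. The outage probability of the secondary link is $$\hat P_{\mathrm{out}}(P_{\max})=\Pr\Big(\frac{g_s}{\sigma^2}\,|\mathbf f^\dagger\mathbf s_s|^2\le\theta_s\Big).$$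 **Statement.** Let $\gamma_{\max}=P_{\max}/\sigma^2$ and $\Gamma(a,x)=\int_x^\infty t^{a-1}e^{-t}\,dt$, and define $$U(P_{\max})=1-\frac{\Gamma(L-1,\theta_s/\gamma_{\max})}{\Gamma(L-1)}+\varphi\,2^{-\frac B{L-1}}+\alpha\,2^{-A},$$ $$\varphi=e^{-\theta_p/\gamma_p}\,\frac{(L-1)\lambda\theta_p\theta_s\,\Gamma(L-2,\theta_s/\gamma_{\max})}{\gamma_p\,\Gamma(L-1)},\qquad \alpha=e^{-\theta_p/\gamma_p}\,\frac{\Gamma(L-1,\theta_s/\gamma_{\max})}{\Gamma(L-1)}.$$ Then $\hat P_{\mathrm{out}}(P_{\max})\le U(P_{\max})$ for every $P_{\max}>0$, and, as $P_{\max}\to\infty$ with the other parameters fixed, $U(P_{\max})$ converges to $\varphi'2^{-B/(L-1)}+\alpha'2^{-A}$, where $$\varphi'=e^{-\theta_p/\gamma_p}\,\frac{(L-1)\lambda\theta_p\theta_s}{(L-2)\gamma_p},\qquad \alpha'=e^{-\theta_p/\gamma_p}.$$ Moreover $\lim_{P_{\max}\to\infty}\hat P_{\mathrm{out}}(P_{\max})$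 exists and $$\lim_{P_{\max}\to\infty}\hat P_{\mathrm{out}}(P_{\max})\le\varphi'\,2^{-\frac B{L-1}}+\alpha'\,2^{-A}.$$ -/

import Mathlib

open MeasureTheory ProbabilityTheory Filter Topology

noncomputable section

namespace CognitiveBeamforming

/-- Deterministic parameters: `L` antennas at the secondary transmitter, `A` bits for the
interference-power-control (IPC) signal, `B` bits for the channel-direction information (CDI),
path-loss factor `lam`, noise variance `sigma2`, primary transmit SNR `gammaP`, and the primary and
secondary SINR/SNR thresholds `thetaP`, `thetaS`. -/
structure Params where
  L : ℕ
  A : ℕ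
  B : ℕ
  lam : ℝ
  sigma2 : ℝ
  gammaP : ℝ
  thetaP : ℝ
  thetaS : ℝ
  one_lt_L : 1 < L
  lam_pos : 0 < lam
  lam_lt_one : lam < 1
  sigma2_pos : 0 < sigma2
  gammaP_pos : 0 < gammaP
  thetaP_pos : 0 < thetaP
  thetaS_pos : 0 < thetaS

/-- Column vectors in `ℂ^L` with the Euclidean norm; `inner ℂ x y` is `x† y`. -/
abbrev Vec (L : ℕ) := EuclideanSpace ℂ (Fin L)

/-- The circularly symmetric complex Gaussian law `CN(0, v)`: independent real and imaginary parts,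
each centred Gaussian with variance `v / 2`. -/
def complexGaussian (v : ℝ) : Measure ℂ :=
  ((gaussianReal 0 (v / 2).toNNReal).prod (gaussianReal 0 (v / 2).toNNReal)).map
    Complex.measurableEquivRealProd.symm

/-- The random vector `h` has i.i.d. `CN(0, v)` entries. -/
def IsIIDComplexGaussian {Ω : Type*} [MeasurableSpace Ω] (μ : Measure Ω) {L : ℕ}
    (h : Ω → Vec L) (v : ℝ) : Prop :=
  iIndepFun (fun (i : Fin L) (ω : Ω) => h ω i) μ ∧
    ∀ i : Fin L, HasLaw (fun ω => h ω i) (complexGaussian v) μ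

/-- The shape `h / ‖h‖` of a channel vector. -/
def shape {L : ℕ} (h : Vec L) : Vec L := ((‖h‖⁻¹ : ℝ) : ℂ) • h

/-- The CDI quantization error `1 - |ŝ† s|²`. -/
def quantError {L : ℕ} (shat s : Vec L) : ℝ := 1 - ‖inner ℂ shat s‖ ^ 2

/-- The random channel model. `hp` is the primary channel, `hx` the channel from the secondary
transmitter to the primary receiver, `hs` the channel from the secondary transmitter to the
secondary receiver; they fade independently. The CDI quantizer sees only the shape of `hx` and may
use a private random seed (which makes the error law below attainable). -/
structure Channel (S : Params) {Ω : Type*} [MeasurableSpace Ω] (μ : Measure Ω)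
    (V : Type*) [MeasurableSpace V] where
  hp : Ω → ℂ
  hx : Ω → Vec S.L
  hs : Ω → Vec S.L
  seed : Ω → V
  quantizer : Vec S.L × V → Vec S.L
  measurable_hp : Measurable hp
  measurable_hx : Measurable hx
  measurable_hs : Measurable hs
  measurable_seed : Measurable seed
  measurable_quantizer : Measurable quantizer
  law_hp : HasLaw hp (complexGaussian 1) μ
  law_hx : IsIIDComplexGaussian μ hx S.lam
  law_hs : IsIIDComplexGaussian μ hs 1
  /- the next three fields say that `hp`, `hs`, `hx`, `seed` are mutually independent -/
  indep_hs : IndepFun hs (fun ω => (hp ω, hx ω, seed ω)) μ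
  indep_hp : IndepFun hp (fun ω => (hx ω, seed ω)) μ
  indep_hx : IndepFun hx seed μ
  /-- The quantized CDI is a unit vector. -/
  norm_quantizer : ∀ᵐ ω ∂μ, ‖quantizer (shape (hx ω), seed ω)‖ = 1
  /-- The distribution function of the quantization error. -/
  quantError_cdf : ∀ τ : ℝ, 0 ≤ τ → τ ≤ (2 : ℝ) ^ (-((S.B : ℝ) / ((S.L : ℝ) - 1))) →
    μ.real {ω | quantError (quantizer (shape (hx ω), seed ω)) (shape (hx ω)) ≤ τ}
      = (2 : ℝ) ^ S.B * τ ^ (S.L - 1)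

namespace Channel

variable {S : Params} {Ω : Type*} [MeasurableSpace Ω] {μ : Measure Ω}
  {V : Type*} [MeasurableSpace V] (C : Channel S μ V)

/-- Primary channel gain. -/
def gp (ω : Ω) : ℝ := ‖C.hp ω‖ ^ 2

/-- Gain of the secondary-transmitter-to-primary-receiver channel, normalized by the path loss. -/
def gx (ω : Ω) : ℝ := ‖C.hx ω‖ ^ 2 / S.lam

/-- Secondary channel gain. -/
def gs (ω : Ω) : ℝ := ‖C.hs ω‖ ^ 2

/-- Shape of the secondary-transmitter-to-primary-receiver channel (the CDI). -/
def sx (ω : Ω) : Vec S.L := shape (C.hx ω)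

/-- Shape of the secondary channel. -/
def ss (ω : Ω) : Vec S.L := shape (C.hs ω)

/-- Quantized CDI. -/
def sxhat (ω : Ω) : Vec S.L := C.quantizer (C.sx ω, C.seed ω)

/-- CDI quantization error `ε`. -/
def eps (ω : Ω) : ℝ := quantError (C.sxhat ω) (C.sx ω)

/-- Interference margin `ω = σ² (γ_p g_p / θ_p - 1)` of the primary receiver. -/
def margin (ω : Ω) : ℝ := S.sigma2 * (S.gammaP * C.gp ω / S.thetaP - 1)

open Classical in
/-- Unquantized IPC signal `η` (no feedforward). -/
def eta (Pmax : ℝ) (ω : Ω) : ℝ :=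
  if 0 ≤ C.margin ω then C.margin ω / (S.lam * C.gx ω * C.eps ω) else Pmax

/-- The event that the primary link is not in outage, `γ_p g_p ≥ θ_p`. -/
def noPrimaryOutage : Set Ω := {ω | S.thetaP ≤ S.gammaP * C.gp ω}

/-- `p 0 < p 1 < ⋯ < p (2^A - 1)` is the equal-probability IPC codebook (values of `p` at larger
indices are irrelevant). -/
structure IsCodebook (Pmax : ℝ) (p : ℕ → ℝ) : Prop where
  zero : p 0 = 0
  strictMono : StrictMonoOn p (Set.Iio (2 ^ S.A))
  cell : ∀ n : ℕ, n + 1 < 2 ^ S.A →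
    (ProbabilityTheory.cond μ C.noPrimaryOutage).real
      {ω | p n < C.eta Pmax ω ∧ C.eta Pmax ω ≤ p (n + 1)} = 1 / (2 : ℝ) ^ S.A
  last : (ProbabilityTheory.cond μ C.noPrimaryOutage).real
      {ω | p (2 ^ S.A - 1) < C.eta Pmax ω} = 1 / (2 : ℝ) ^ S.A

/-- `⌊x⌋_𝒫`: the largest codebook element not exceeding `x` (for `x ≥ 0 = p 0`, the supremum is that
of a finite nonempty set). -/
def codebookFloor (A : ℕ) (p : ℕ → ℝ) (x : ℝ) : ℝ :=
  sSup (p '' Set.Iio (2 ^ A) ∩ Set.Iic x)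

open Classical in
/-- Quantized IPC signal `η̂`. -/
def etahat (Pmax : ℝ) (p : ℕ → ℝ) (ω : Ω) : ℝ :=
  if 0 ≤ C.margin ω ∧ C.eta Pmax ω < Pmax then codebookFloor S.A p (C.eta Pmax ω) else Pmax

end Channel

/-- `f` is an orthogonal cognitive beamformer: it maximizes `|f† s|²` subject to `f† ŝ = 0` and
`‖f‖² ≤ P`. -/
structure IsOCBeamformer {L : ℕ} (shat s : Vec L) (P : ℝ) (f : Vec L) : Prop where
  orthogonal : inner ℂ f shat = 0
  power : ‖f‖ ^ 2 ≤ P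
  optimal : ∀ g : Vec L, inner ℂ g shat = 0 → ‖g‖ ^ 2 ≤ P →
    ‖inner ℂ g s‖ ^ 2 ≤ ‖inner ℂ f s‖ ^ 2

/-- Secondary outage probability `Pr(SNR_s ≤ θ_s)`, `SNR_s = (g_s / σ²) |f† s_s|²`, for the random
beamformer `f`. -/
def outageProb {S : Params} {Ω : Type*} [MeasurableSpace Ω] {μ : Measure Ω}
    {V : Type*} [MeasurableSpace V] (C : Channel S μ V) (f : Ω → Vec S.L) : ℝ :=
  μ.real {ω | C.gs ω / S.sigma2 * ‖inner ℂ (f ω) (C.ss ω)‖ ^ 2 ≤ S.thetaS}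

/-- Upper incomplete gamma function `Γ(a, x)`. -/
def incGamma (a x : ℝ) : ℝ := ∫ t in Set.Ioi x, t ^ (a - 1) * Real.exp (-t)

namespace Params

variable (S : Params)

/-- `θ_s / γ_max` with `γ_max = Pmax / σ²`. -/
def ratio (Pmax : ℝ) : ℝ := S.thetaS / (Pmax / S.sigma2)

/-- The coefficient `φ`. -/
def phi (Pmax : ℝ) : ℝ :=
  Real.exp (-(S.thetaP / S.gammaP)) *
    ((((S.L : ℝ) - 1) * S.lam * S.thetaP * S.thetaS * incGamma ((S.L : ℝ) - 2) (S.ratio Pmax)) /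
      (S.gammaP * Real.Gamma ((S.L : ℝ) - 1)))

/-- The coefficient `α`. -/
def alpha (Pmax : ℝ) : ℝ :=
  Real.exp (-(S.thetaP / S.gammaP)) *
    (incGamma ((S.L : ℝ) - 1) (S.ratio Pmax) / Real.Gamma ((S.L : ℝ) - 1))

/-- The upper bound on the outage probability with quantized CDI and IPC feedback. -/
def outageBound (Pmax : ℝ) : ℝ :=
  1 - incGamma ((S.L : ℝ) - 1) (S.ratio Pmax) / Real.Gamma ((S.L : ℝ) - 1)
    + S.phi Pmax * (2 : ℝ) ^ (-((S.B : ℝ) / ((S.L : ℝ) - 1)))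
    + S.alpha Pmax * (2 : ℝ) ^ (-(S.A : ℝ))

/-- The limiting coefficient `φ'`. -/
def phi' : ℝ :=
  Real.exp (-(S.thetaP / S.gammaP)) *
    ((((S.L : ℝ) - 1) * S.lam * S.thetaP * S.thetaS) / (((S.L : ℝ) - 2) * S.gammaP))

/-- The limiting coefficient `α'`. -/
def alpha' : ℝ := Real.exp (-(S.thetaP / S.gammaP))

/-- The limiting bound `φ' 2^{-B/(L-1)} + α' 2^{-A}`. -/
def limitBound : ℝ :=
  S.phi' * (2 : ℝ) ^ (-((S.B : ℝ) / ((S.L : ℝ) - 1))) + S.alpha' * (2 : ℝ) ^ (-(S.A : ℝ))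

end Params

end CognitiveBeamforming

end

/-!
The beamforming gain is `η̂ · R`, where `R` is the squared length of the component of `h_s`
orthogonal to the quantized CDI. As that direction is independent of `h_s`, `R` is `Γ(L - 1, 1)`
distributed and independent of `η̂`, so outage is an event about a product of independent variables.

Given that the primary link is not in outage, memorylessness of the exponential gain `g_p` makes
`η` a ratio `X / W` with `X` exponential and `W` an independent positive multiple of `λ g_x ε`.
Hence `Pr(η ≤ t) ≤ E[W] t`. Rounding `η` down to the codebook only adds one cell, of probability
`2⁻ᴬ`, and `E[W]` is explicit because length and direction of `h_x` are independent. Integrating the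
resulting affine bound on the law of `η̂` against the Gamma density on `R > θ_s σ² / Pmax` gives
`U(Pmax)`. The codebook is determined by the conditional law of `η`, which does not involve `Pmax`;
so for large `Pmax` the outage event is eventually constant, almost surely, and its probability
converges.
-/
noncomputable section

namespace CognitiveBeamforming

open scoped ENNReal

section RadialGaussian

/-- `γ` is the centred Gaussian measure whose density with respect to some Haar measure is
`exp (-‖x‖² / v)`; leaving the Haar measure free absorbs the normalizing constant. -/
def IsRadialGaussian {E : Type*} [NormedAddCommGroup E] [MeasurableSpace E] (γ : Measure E)
    (v : ℝ) : Prop :=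
  ∃ H : Measure E, H.IsAddHaarMeasure ∧
    γ = H.withDensity fun x => ENNReal.ofReal (Real.exp (-(‖x‖ ^ 2 / v)))

theorem IsRadialGaussian.of_eq_smul {E : Type*} [NormedAddCommGroup E] [MeasurableSpace E]
    {γ : Measure E} [IsProbabilityMeasure γ] {H : Measure E} [H.IsAddHaarMeasure]
    {a : ℝ≥0∞} {v : ℝ}
    (h : γ = a • H.withDensity fun x => ENNReal.ofReal (Real.exp (-(‖x‖ ^ 2 / v)))) :
    IsRadialGaussian γ v := by
  have total := congrArg (fun m : Measure E => m Set.univ) h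
  simp only [measure_univ, Measure.smul_apply, smul_eq_mul] at total
  have ha0 : a ≠ 0 := by
    rintro rfl
    simp at total
  have ha : a ≠ ∞ := by
    rintro rfl
    rw [ENNReal.top_mul'] at total
    split_ifs at total <;> simp at total
  exact ⟨a • H, .smul H ha0 ha, by rw [h, withDensity_smul_measure]⟩

theorem map_withDensity_comp {α β : Type*} [MeasurableSpace α] [MeasurableSpace β] {m : Measure α}
    {e : α → β} (he : Measurable e) {g : β → ℝ≥0∞} (hg : Measurable g) :
    (m.withDensity (fun x => g (e x))).map e = (m.map e).withDensity g := by
  ext s hs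
  rw [Measure.map_apply he hs, withDensity_apply _ (he hs), withDensity_apply _ hs,
    setLIntegral_map hs hg he]

section Polar

variable {E : Type*} [NormedAddCommGroup E] [NormedSpace ℝ E] [FiniteDimensional ℝ E]
  [MeasurableSpace E] [BorelSpace E]

theorem lintegral_norm_mul_direction [Nontrivial E] (H : Measure E) [H.IsAddHaarMeasure]
    {f : ℝ → ℝ≥0∞} (hf : Measurable f) {φ : E → ℝ≥0∞} (hφ : Measurable φ) :
    ∫⁻ x, f ‖x‖ * φ (‖x‖⁻¹ • x) ∂H =
      (∫⁻ s : Metric.sphere (0 : E) 1, φ s ∂H.toSphere) *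
        ∫⁻ r in Set.Ioi (0 : ℝ), ENNReal.ofReal (r ^ (Module.finrank ℝ E - 1)) * f r := by
  have polar := (H.measurePreserving_homeomorphUnitSphereProd).lintegral_comp
    (f := fun p : Metric.sphere (0 : E) 1 × Set.Ioi (0 : ℝ) => φ p.1.1 * f p.2.1) (by fun_prop)
  simp only [homeomorphUnitSphereProd_apply_snd_coe, homeomorphUnitSphereProd_apply_fst_coe,
    lintegral_subtype_comap (measurableSet_singleton (0 : E)).compl
      (fun x : E => φ (‖x‖⁻¹ • x) * f ‖x‖), restrict_compl_singleton] at polar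
  simp_rw [mul_comm (f _)]
  rw [polar, lintegral_prod_mul (f := fun s : Metric.sphere (0 : E) 1 => φ s)
    (g := fun r : Set.Ioi (0 : ℝ) => f r) (by fun_prop) (by fun_prop), Measure.volumeIoiPow,
    lintegral_withDensity_eq_lintegral_mul _ (by fun_prop) (by fun_prop)]
  congr 1
  exact lintegral_subtype_comap measurableSet_Ioi
    (fun r : ℝ => ENNReal.ofReal (r ^ (Module.finrank ℝ E - 1)) * f r)

theorem lintegral_gammaMeasure {a r : ℝ} {f : ℝ → ℝ≥0∞} (hf : Measurable f) :
    ∫⁻ x, f x ∂(gammaMeasure a r) = ∫⁻ x in Set.Ioi (0 : ℝ), gammaPDF a r x * f x := by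
  have hm : Measurable (gammaPDF a r) := (measurable_gammaPDFReal a r).ennreal_ofReal
  have vanish : ∫⁻ x in Set.Iio (0 : ℝ), (gammaPDF a r * f) x = 0 :=
    setLIntegral_eq_zero measurableSet_Iio fun x hx => by simp [gammaPDF_of_neg hx]
  rw [gammaMeasure, lintegral_withDensity_eq_lintegral_mul _ hm hf,
    ← lintegral_add_compl _ (measurableSet_Ioi (a := (0 : ℝ))), Set.compl_Ioi,
    ← setLIntegral_congr Iio_ae_eq_Iic, vanish, add_zero]
  rfl

theorem lintegral_Ioi_comp_sq (g : ℝ → ℝ≥0∞) :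
    ∫⁻ r in Set.Ioi (0 : ℝ), ENNReal.ofReal (2 * r) * g (r ^ 2) = ∫⁻ x in Set.Ioi (0 : ℝ), g x := by
  have image_sq : (fun r : ℝ => r ^ 2) '' Set.Ioi (0 : ℝ) = Set.Ioi 0 := by
    ext x
    exact ⟨fun ⟨r, hr, h⟩ => h ▸ pow_pos (Set.mem_Ioi.1 hr) 2,
      fun hx => ⟨√x, Real.sqrt_pos.2 hx, Real.sq_sqrt (le_of_lt hx)⟩⟩
  have injOn_sq : Set.InjOn (fun r : ℝ => r ^ 2) (Set.Ioi 0) := fun x hx y hy h =>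
    (pow_left_inj₀ (le_of_lt hx) (le_of_lt hy) two_ne_zero).1 h
  conv_rhs => rw [← image_sq, lintegral_image_eq_lintegral_abs_deriv_mul measurableSet_Ioi
    (fun x _ => (hasDerivAt_pow 2 x).hasDerivWithinAt) injOn_sq]
  refine setLIntegral_congr_fun measurableSet_Ioi fun r hr => ?_
  have hr : 0 < r := hr
  simp [abs_of_pos hr]

theorem lintegral_Ioi_pow_mul_exp_neg_sq {d : ℕ} (hd : 0 < d) {v : ℝ} (hv : 0 < v)
    {f : ℝ → ℝ≥0∞} (hf : Measurable f) :
    ∫⁻ r in Set.Ioi (0 : ℝ), ENNReal.ofReal (r ^ (d - 1)) *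
        (ENNReal.ofReal (Real.exp (-(r ^ 2 / v))) * f (r ^ 2)) =
      ENNReal.ofReal (v ^ (d / 2 : ℝ) * Real.Gamma (d / 2) / 2) *
        ∫⁻ x, f x ∂(gammaMeasure (d / 2) v⁻¹) := by
  have hm : Measurable (gammaPDF (d / 2) v⁻¹) := (measurable_gammaPDFReal _ _).ennreal_ofReal
  have : 0 < Real.Gamma (d / 2) := Real.Gamma_pos_of_pos (by positivity)
  rw [lintegral_gammaMeasure hf, ← lintegral_const_mul _ (by exact hm.mul hf)]
  conv_rhs => rw [← lintegral_Ioi_comp_sq]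
  refine setLIntegral_congr_fun measurableSet_Ioi fun r hr => ?_
  have hr : 0 < r := hr
  have hpow : r * (r ^ 2) ^ ((d : ℝ) / 2 - 1) = r ^ (d - 1) := by
    rw [← Real.rpow_natCast r 2, ← Real.rpow_mul hr.le, ← Real.rpow_natCast r (d - 1),
      Nat.cast_pred hd]
    nth_rewrite 1 [← Real.rpow_one r]
    rw [← Real.rpow_add hr]
    congr 1
    push_cast
    ring
  rw [gammaPDF_of_nonneg (by positivity), ← mul_assoc, ← mul_assoc, ← mul_assoc,
    ← ENNReal.ofReal_mul (by positivity), ← ENNReal.ofReal_mul (by positivity),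
    ← ENNReal.ofReal_mul (by positivity), ← hpow, Real.inv_rpow hv.le]
  congr 2
  field_simp

/-- Both the law of the squared norm and its independence of the direction are read off from this
factorization. -/
theorem IsRadialGaussian.lintegral_norm_sq_mul_direction [Nontrivial E] {γ : Measure E}
    [IsProbabilityMeasure γ] {v : ℝ} (hv : 0 < v) (h : IsRadialGaussian γ v)
    {f : ℝ → ℝ≥0∞} (hf : Measurable f) {φ : E → ℝ≥0∞} (hφ : Measurable φ) :
    ∫⁻ x, f (‖x‖ ^ 2) * φ (‖x‖⁻¹ • x) ∂γ =
      (∫⁻ t, f t ∂(gammaMeasure (Module.finrank ℝ E / 2) v⁻¹)) *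
        ∫⁻ x, φ (‖x‖⁻¹ • x) ∂γ := by
  obtain ⟨H, hH, rfl⟩ := h
  have hd : 0 < Module.finrank ℝ E := Module.finrank_pos
  have := isProbabilityMeasure_gammaMeasure (a := Module.finrank ℝ E / 2) (by positivity)
    (inv_pos.2 hv)
  have factor : ∀ f : ℝ → ℝ≥0∞, Measurable f → ∫⁻ x, f (‖x‖ ^ 2) * φ (‖x‖⁻¹ • x)
      ∂(H.withDensity fun x => ENNReal.ofReal (Real.exp (-(‖x‖ ^ 2 / v)))) =
      (∫⁻ s : Metric.sphere (0 : E) 1, φ s ∂H.toSphere) *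
      (ENNReal.ofReal (v ^ (Module.finrank ℝ E / 2 : ℝ) * Real.Gamma (Module.finrank ℝ E / 2) / 2) *
        ∫⁻ x, f x ∂(gammaMeasure (Module.finrank ℝ E / 2) v⁻¹)) := by
    intro f hf
    rw [lintegral_withDensity_eq_lintegral_mul _ (by fun_prop) (by fun_prop),
      ← lintegral_Ioi_pow_mul_exp_neg_sq hd hv hf, ← lintegral_norm_mul_direction H
        (f := fun r => ENNReal.ofReal (Real.exp (-(r ^ 2 / v))) * f (r ^ 2)) (by fun_prop) hφ]
    simp only [Pi.mul_apply, mul_assoc]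
  have total := factor (fun _ => 1) measurable_const
  simp only [one_mul, lintegral_const, measure_univ, mul_one] at total
  rw [factor f hf, total, ← mul_assoc, mul_comm]

theorem IsRadialGaussian.map_norm_sq [Nontrivial E] {γ : Measure E} [IsProbabilityMeasure γ]
    {v : ℝ} (hv : 0 < v) (h : IsRadialGaussian γ v) :
    γ.map (fun x => ‖x‖ ^ 2) = gammaMeasure (Module.finrank ℝ E / 2) v⁻¹ := by
  refine Measure.ext_of_lintegral _ fun f hf => ?_
  rw [lintegral_map hf (by fun_prop)]
  simpa using h.lintegral_norm_sq_mul_direction hv hf (φ := fun _ => 1) measurable_const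

theorem IsRadialGaussian.indepFun_norm_sq_direction [Nontrivial E] {γ : Measure E}
    [IsProbabilityMeasure γ] {v : ℝ} (hv : 0 < v) (h : IsRadialGaussian γ v) :
    IndepFun (fun x => ‖x‖ ^ 2) (fun x => ‖x‖⁻¹ • x) γ := by
  rw [indepFun_iff_measure_inter_preimage_eq_mul]
  intro s t hs ht
  have hn : Measurable fun x : E => ‖x‖ ^ 2 := by fun_prop
  have hdir : Measurable fun x : E => ‖x‖⁻¹ • x := by fun_prop
  have := h.lintegral_norm_sq_mul_direction hv (measurable_one.indicator hs)
    (measurable_one.indicator ht)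
  rw [← h.map_norm_sq hv, lintegral_indicator_one hs, Measure.map_apply hn hs] at this
  rw [← lintegral_indicator_one (hdir ht), ← lintegral_indicator_one ((hn hs).inter (hdir ht)),
    Set.inter_indicator_one]
  exact this

end Polar

section Projection

theorem norm_sq_orthogonalProjectionOnto_orthogonal_singleton {𝕜 E : Type*} [RCLike 𝕜]
    [NormedAddCommGroup E] [InnerProductSpace 𝕜 E] {u : E} (hu : ‖u‖ = 1)
    (x : E) :
    ‖(𝕜 ∙ u)ᗮ.orthogonalProjectionOnto x‖ ^ 2 = ‖x‖ ^ 2 - ‖inner 𝕜 u x‖ ^ 2 := by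
  have pythagoras := (𝕜 ∙ u).norm_sq_eq_add_norm_sq_projection x
  rw [Submodule.coe_norm ((𝕜 ∙ u).orthogonalProjectionOnto x),
    ← Submodule.starProjection_apply, Submodule.starProjection_unit_singleton 𝕜 hu, norm_smul,
    hu, mul_one] at pythagoras
  linarith

variable {𝕜 E : Type*} [RCLike 𝕜] [NormedAddCommGroup E] [InnerProductSpace 𝕜 E]
  [FiniteDimensional 𝕜 E] [MeasurableSpace E] [BorelSpace E]

theorem IsRadialGaussian.map_orthogonalProjectionOnto {γ : Measure E} [IsProbabilityMeasure γ]
    {v : ℝ} (h : IsRadialGaussian γ v) (K : Submodule 𝕜 E) :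
    IsRadialGaussian (γ.map K.orthogonalProjectionOnto) v := by
  obtain ⟨H, hH, hγ⟩ := h
  have := FiniteDimensional.proper_rclike 𝕜 E
  let e : E ≃L[𝕜] K × Kᗮ := K.orthogonalDecomposition.toContinuousLinearEquiv.trans
    (WithLp.prodContinuousLinearEquiv 2 𝕜 K Kᗮ)
  let g (F : Type _) [NormedAddCommGroup F] : F → ℝ≥0∞ :=
    fun x => ENNReal.ofReal (Real.exp (-(‖x‖ ^ 2 / v)))
  have density : ∀ x, g E x = g K (e x).1 * g Kᗮ (e x).2 := by
    intro x
    have pythagoras := K.norm_sq_eq_add_norm_sq_projection x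
    simp only [g, ← ENNReal.ofReal_mul (Real.exp_pos _).le, ← Real.exp_add]
    congr 2
    rw [pythagoras]
    simp only [Submodule.coe_norm, Submodule.coe_orthogonalProjectionOnto_apply,
      Submodule.starProjection_orthogonal_val, ContinuousLinearEquiv.trans_apply,
      LinearIsometryEquiv.coe_toContinuousLinearEquiv, Submodule.orthogonalDecomposition_apply,
      WithLp.prodContinuousLinearEquiv_apply, e]
    ring
  have hHe : (H.map e).IsAddHaarMeasure := e.isAddHaarMeasure_map H
  have hmap : γ.map e = (H.map e).withDensity fun z => g K z.1 * g Kᗮ z.2 := by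
    rw [hγ, ← map_withDensity_comp (by fun_prop) (by fun_prop)]
    simp only [← density, g]
  obtain ⟨c, hc⟩ : ∃ c : ℝ≥0∞, H.map e = c • Measure.addHaar.prod Measure.addHaar :=
    ⟨_, Measure.isAddLeftInvariant_eq_smul _ _⟩
  rw [hc, withDensity_smul_measure, ← prod_withDensity (by fun_prop) (by fun_prop)] at hmap
  have hP : Measurable K.orthogonalProjectionOnto := by fun_prop
  have := Measure.isProbabilityMeasure_map (μ := γ) hP.aemeasurable
  refine .of_eq_smul (H := Measure.addHaar)
    (a := c * (Measure.addHaar.withDensity (g Kᗮ)) Set.univ) ?_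
  calc γ.map K.orthogonalProjectionOnto = (γ.map e).map Prod.fst := by
        rw [Measure.map_map measurable_fst (by fun_prop)]
        rfl
    _ = _ := by rw [hmap, Measure.map_smul, Measure.map_fst_prod, smul_smul]

theorem IsRadialGaussian.map_norm_sq_sub_norm_inner_sq {F : Type*} [NormedAddCommGroup F]
    [InnerProductSpace ℂ F] [FiniteDimensional ℂ F] [MeasurableSpace F] [BorelSpace F]
    {γ : Measure F} [IsProbabilityMeasure γ] {v : ℝ} (hv : 0 < v) (h : IsRadialGaussian γ v)
    (hF : 1 < Module.finrank ℂ F) {u : F} (hu : ‖u‖ = 1) :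
    γ.map (fun x => ‖x‖ ^ 2 - ‖inner ℂ u x‖ ^ 2) =
      gammaMeasure (Module.finrank ℂ F - 1) v⁻¹ := by
  obtain ⟨n, hn⟩ := Nat.exists_eq_add_of_lt hF
  have : Fact (Module.finrank ℂ F = n + 1 + 1) := ⟨by omega⟩
  have hrank : Module.finrank ℝ (ℂ ∙ u)ᗮ = 2 * (n + 1) := by
    rw [finrank_real_of_complex, Submodule.finrank_orthogonal_span_singleton (n := n + 1) (by
      rintro rfl
      simp at hu)]
  have : Nontrivial (ℂ ∙ u)ᗮ := Module.nontrivial_of_finrank_pos (R := ℝ) (by omega)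
  have hP : Measurable (ℂ ∙ u)ᗮ.orthogonalProjectionOnto := by fun_prop
  have := Measure.isProbabilityMeasure_map (μ := γ) hP.aemeasurable
  have hlaw := (h.map_orthogonalProjectionOnto (ℂ ∙ u)ᗮ).map_norm_sq hv
  rw [Measure.map_map (by fun_prop) hP, hrank] at hlaw
  simp only [Function.comp_def, norm_sq_orthogonalProjectionOnto_orthogonal_singleton hu] at hlaw
  rw [hlaw, hn]
  congr 1
  push_cast
  ring

end Projection

end RadialGaussian

section ComplexGaussian

instance isProbabilityMeasure_complexGaussian (v : ℝ) :
    IsProbabilityMeasure (complexGaussian v) :=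
  Measure.isProbabilityMeasure_map Complex.measurableEquivRealProd.symm.measurable.aemeasurable

theorem isRadialGaussian_complexGaussian {v : ℝ} (hv : 0 < v) :
    IsRadialGaussian (complexGaussian v) v := by
  have hw : (v / 2).toNNReal ≠ 0 := (Real.toNNReal_pos.2 (by positivity)).ne'
  have hcoe : ((v / 2).toNNReal : ℝ) = v / 2 := Real.coe_toNNReal _ (by positivity)
  refine .of_eq_smul (H := volume) (a := ENNReal.ofReal (Real.pi * v)⁻¹) ?_
  have density : ∀ z : ℂ, gaussianPDF 0 (v / 2).toNNReal z.re * gaussianPDF 0 (v / 2).toNNReal z.im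
      = ENNReal.ofReal (Real.pi * v)⁻¹ * ENNReal.ofReal (Real.exp (-(‖z‖ ^ 2 / v))) := by
    intro z
    rw [gaussianPDF, gaussianPDF, ← ENNReal.ofReal_mul (gaussianPDFReal_nonneg _ _ _),
      ← ENNReal.ofReal_mul (by positivity), gaussianPDFReal, gaussianPDFReal, mul_mul_mul_comm,
      ← Real.exp_add, ← mul_inv, Real.mul_self_sqrt (by positivity), hcoe, Complex.sq_norm,
      Complex.normSq_apply]
    congr 2
    · congr 1
      ring
    · ring_nf
  rw [complexGaussian, gaussianReal_of_var_ne_zero _ hw,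
    prod_withDensity (measurable_gaussianPDF _ _) (measurable_gaussianPDF _ _),
    ← Measure.volume_eq_prod, ← withDensity_smul _ (by fun_prop),
    ← Complex.volume_preserving_equiv_real_prod.symm.map_eq,
    ← map_withDensity_comp (MeasurableEquiv.measurable _) (by fun_prop)]
  congr 2
  ext x
  exact density (Complex.measurableEquivRealProd.symm x)

theorem lintegral_pi_prod {α : Type*} [MeasurableSpace α] (m : Measure α) [SigmaFinite m]
    {n : ℕ} {f : Fin n → α → ℝ≥0∞} (hf : ∀ i, Measurable (f i)) :
    ∫⁻ x, ∏ i, f i (x i) ∂(Measure.pi fun _ : Fin n => m) = ∏ i, ∫⁻ a, f i a ∂m := by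
  induction n with
  | zero => simp
  | succ n ih =>
    have split := (measurePreserving_piFinSuccAbove (fun _ : Fin (n + 1) => m) 0).symm
    rw [← split.lintegral_comp (by fun_prop), Fin.prod_univ_succ, ← ih (fun i => hf _),
      ← lintegral_prod_mul (g := fun x : Fin n → α => ∏ i : Fin n, f i.succ (x i))
        (hf 0).aemeasurable
        (Finset.measurable_prod _ fun i _ => (hf _).comp (measurable_pi_apply i)).aemeasurable]
    simp [Fin.prod_univ_succ, MeasurableEquiv.piFinSuccAbove]

theorem pi_withDensity {α : Type*} [MeasurableSpace α] (m : Measure α) [SigmaFinite m]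
    {n : ℕ} {f : α → ℝ≥0∞} (hf : Measurable f) [SigmaFinite (m.withDensity f)] :
    (Measure.pi fun _ : Fin n => m.withDensity f) =
      (Measure.pi fun _ : Fin n => m).withDensity fun x => ∏ i, f (x i) := by
  refine Measure.pi_eq fun s hs => ?_
  have indicator_prod : (Set.univ.pi s).indicator (fun x : Fin n → α => ∏ i, f (x i)) =
      fun x => ∏ i, (s i).indicator f (x i) := by
    ext x
    by_cases hx : ∀ i, x i ∈ s i
    · simp [hx]
    · obtain ⟨i, hi⟩ := not_forall.1 hx
      rw [Set.indicator_of_notMem (by simpa using ⟨i, hi⟩),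
        Finset.prod_eq_zero (Finset.mem_univ i) (Set.indicator_of_notMem hi f)]
  rw [withDensity_apply _ (.univ_pi hs), ← lintegral_indicator (.univ_pi hs), indicator_prod,
    lintegral_pi_prod m fun i => hf.indicator (hs i)]
  simp [lintegral_indicator, hs]

theorem IsIIDComplexGaussian.isRadialGaussian {Ω : Type*} [MeasurableSpace Ω] {μ : Measure Ω}
    [IsProbabilityMeasure μ] {n : ℕ} {h : Ω → Vec n} {v : ℝ} (hv : 0 < v)
    (hh : IsIIDComplexGaussian μ h v) (hm : Measurable h) : IsRadialGaussian (μ.map h) v := by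
  obtain ⟨H, hH, hγ⟩ := isRadialGaussian_complexGaussian hv
  have coordinates := (iIndepFun_iff_map_fun_eq_pi_map (fun i => by fun_prop)).1 hh.1
  simp_rw [fun i => (hh.2 i).map_eq] at coordinates
  have : IsProbabilityMeasure (H.withDensity fun x => ENNReal.ofReal (Real.exp (-(‖x‖ ^ 2 / v)))) :=
    hγ ▸ inferInstance
  refine ⟨(Measure.pi fun _ : Fin n => H).map (PiLp.continuousLinearEquiv 2 ℝ
    (fun _ : Fin n => ℂ)).symm, ContinuousLinearEquiv.isAddHaarMeasure_map _ _, ?_⟩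
  have density : ∀ x : Fin n → ℂ, ∏ i, ENNReal.ofReal (Real.exp (-(‖x i‖ ^ 2 / v))) =
      ENNReal.ofReal (Real.exp (-(‖WithLp.toLp 2 x‖ ^ 2 / v))) := by
    intro x
    rw [← ENNReal.ofReal_prod_of_nonneg (fun i _ => (Real.exp_pos _).le), ← Real.exp_sum,
      EuclideanSpace.norm_sq_eq, Finset.sum_neg_distrib, Finset.sum_div]
  rw [hγ, pi_withDensity H (by fun_prop)] at coordinates
  simp_rw [density] at coordinates
  calc μ.map h = (μ.map fun ω i => h ω i).map (WithLp.toLp 2) := by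
        rw [Measure.map_map (by fun_prop) (by fun_prop)]
        rfl
    _ = _ := by
        rw [coordinates, map_withDensity_comp (WithLp.measurable_toLp 2 _)
          (g := fun x : Vec n => ENNReal.ofReal (Real.exp (-(‖x‖ ^ 2 / v)))) (by fun_prop)]
        rfl

end ComplexGaussian

section Beamformer

variable {𝕜 E : Type*} [RCLike 𝕜] [NormedAddCommGroup E] [InnerProductSpace 𝕜 E]
  (K : Submodule 𝕜 E) [K.HasOrthogonalProjection]

theorem norm_inner_le_norm_mul_norm_orthogonalProjectionOnto {f : E} (hf : f ∈ K) (s : E) :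
    ‖inner 𝕜 f s‖ ≤ ‖f‖ * ‖K.orthogonalProjectionOnto s‖ := by
  have := norm_inner_le_norm (𝕜 := 𝕜) (⟨f, hf⟩ : K) (K.orthogonalProjectionOnto s)
  rwa [Submodule.inner_orthogonalProjectionOnto_eq_of_mem_left] at this

theorem exists_mem_norm_sq_le_and_norm_inner_sq_eq {P : ℝ} (hP : 0 ≤ P) (s : E) :
    ∃ g ∈ K, ‖g‖ ^ 2 ≤ P ∧ ‖inner 𝕜 g s‖ ^ 2 = P * ‖K.orthogonalProjectionOnto s‖ ^ 2 := by
  set w := K.orthogonalProjectionOnto s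
  rcases eq_or_ne w 0 with hw | hw
  · exact ⟨0, K.zero_mem, by simpa using hP, by simp [hw]⟩
  have hw : ‖w‖ ≠ 0 := norm_ne_zero_iff.2 hw
  have inner_w : ‖inner 𝕜 (w : E) s‖ = ‖w‖ ^ 2 := by
    rw [← Submodule.inner_orthogonalProjectionOnto_eq_of_mem_left, inner_self_eq_norm_sq_to_K]
    simp
  refine ⟨((√P / ‖w‖ : ℝ) : 𝕜) • (w : E), K.smul_mem _ w.2, le_of_eq ?_, ?_⟩
  · rw [norm_smul, RCLike.norm_ofReal, abs_of_nonneg (by positivity), ← Submodule.coe_norm,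
      div_mul_cancel₀ _ hw, Real.sq_sqrt hP]
  · rw [inner_smul_left, norm_mul, RCLike.norm_conj, RCLike.norm_ofReal,
      abs_of_nonneg (by positivity), inner_w, mul_pow, div_pow, Real.sq_sqrt hP]
    field_simp

theorem IsOCBeamformer.norm_inner_sq {L : ℕ} {u s f : Vec L} {P : ℝ} (h : IsOCBeamformer u s P f)
    (hP : 0 ≤ P) (hu : ‖u‖ = 1) :
    ‖inner ℂ f s‖ ^ 2 = P * (‖s‖ ^ 2 - ‖inner ℂ u s‖ ^ 2) := by
  rw [← norm_sq_orthogonalProjectionOnto_orthogonal_singleton hu]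
  obtain ⟨g, hg, hgP, hgs⟩ := exists_mem_norm_sq_le_and_norm_inner_sq_eq (ℂ ∙ u)ᗮ hP s
  refine le_antisymm ?_
    (hgs ▸ h.optimal g (Submodule.mem_orthogonal_singleton_iff_inner_left.1 hg) hgP)
  calc ‖inner ℂ f s‖ ^ 2 ≤ (‖f‖ * ‖(ℂ ∙ u)ᗮ.orthogonalProjectionOnto s‖) ^ 2 := by
        gcongr
        exact norm_inner_le_norm_mul_norm_orthogonalProjectionOnto _
          (Submodule.mem_orthogonal_singleton_iff_inner_left.2 h.orthogonal) s
    _ ≤ P * ‖(ℂ ∙ u)ᗮ.orthogonalProjectionOnto s‖ ^ 2 := by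
        rw [mul_pow]
        gcongr
        exact h.power

theorem norm_sq_mul_shape {L : ℕ} (u h : Vec L) :
    ‖h‖ ^ 2 * (‖shape h‖ ^ 2 - ‖inner ℂ u (shape h)‖ ^ 2) = ‖h‖ ^ 2 - ‖inner ℂ u h‖ ^ 2 := by
  rcases eq_or_ne h 0 with rfl | h0
  · simp
  · have : 0 < ‖h‖ := norm_pos_iff.2 h0
    rw [shape, inner_smul_right, norm_smul, norm_mul, Complex.norm_real,
      Real.norm_of_nonneg (by positivity)]
    field_simp

end Beamformer

section Gamma

open Set

theorem lintegral_id_gammaMeasure {a r : ℝ} (ha : 0 < a) (hr : 0 < r) :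
    ∫⁻ x, ENNReal.ofReal x ∂(gammaMeasure a r) = ENNReal.ofReal (a / r) := by
  have := isProbabilityMeasure_gammaMeasure (add_pos ha one_pos) hr
  have total_mass : ∫⁻ _, 1 ∂(gammaMeasure (a + 1) r) = 1 := by simp
  rw [lintegral_gammaMeasure measurable_const] at total_mass
  rw [lintegral_gammaMeasure (by fun_prop), ← mul_one (ENNReal.ofReal (a / r)), ← total_mass,
    ← lintegral_const_mul' _ _ ENNReal.ofReal_ne_top]
  refine setLIntegral_congr_fun measurableSet_Ioi fun x (hx : 0 < x) => ?_
  have : 0 < Real.Gamma a := Real.Gamma_pos_of_pos ha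
  rw [gammaPDF_of_nonneg hx.le, gammaPDF_of_nonneg hx.le, mul_one,
    ← ENNReal.ofReal_mul (by positivity), ← ENNReal.ofReal_mul (by positivity)]
  congr 1
  rw [Real.Gamma_add_one ha.ne', Real.rpow_add_one hr.ne', add_sub_cancel_right,
    show x ^ a = x ^ (a - 1) * x by rw [← Real.rpow_add_one hx.ne', sub_add_cancel]]
  field_simp

theorem integrableOn_rpow_mul_exp_neg_Ioi {a x : ℝ} (ha : 0 < a) (hx : 0 ≤ x) :
    IntegrableOn (fun t : ℝ => t ^ (a - 1) * Real.exp (-t)) (Ioi x) := by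
  simpa only [mul_comm] using (Real.GammaIntegral_convergent ha).mono_set (Ioi_subset_Ioi hx)

theorem tendsto_incGamma {a : ℝ} (ha : 0 < a) {ι : Type*} {l : Filter ι}
    [l.IsCountablyGenerated] {u : ι → ℝ} (hu : Tendsto u l (𝓝 0)) (hu0 : ∀ᶠ i in l, 0 ≤ u i) :
    Tendsto (fun i => incGamma a (u i)) l (𝓝 (Real.Gamma a)) := by
  have h := (aecover_Ioi_of_Ioi (μ := volume) hu).integral_tendsto_of_countably_generated
    (integrableOn_rpow_mul_exp_neg_Ioi ha le_rfl)
  simp only [Real.Gamma_eq_integral ha, mul_comm (Real.exp _)]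
  refine h.congr' ?_
  filter_upwards [hu0] with i hi
  rw [incGamma, Measure.restrict_restrict measurableSet_Ioi,
    inter_eq_left.2 (Ioi_subset_Ioi hi)]

theorem setIntegral_rpow_gammaMeasure {a x : ℝ} (b : ℝ) (ha : 0 < a) (hx : 0 ≤ x) :
    ∫ g in Ioi x, g ^ b ∂(gammaMeasure a 1) = incGamma (a + b) x / Real.Gamma a := by
  rw [gammaMeasure, setIntegral_withDensity_eq_setIntegral_toReal_smul
    (f := gammaPDF a 1) (measurable_gammaPDFReal a 1).ennreal_ofReal
    (ae_of_all _ fun _ => ENNReal.ofReal_lt_top) _ measurableSet_Ioi,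
    incGamma, ← integral_div]
  refine setIntegral_congr_fun measurableSet_Ioi fun t ht => ?_
  have ht : 0 < t := hx.trans_lt ht
  have : 0 < Real.Gamma a := Real.Gamma_pos_of_pos ha
  simp only [gammaPDF_of_nonneg ht.le, smul_eq_mul]
  rw [ENNReal.toReal_ofReal (by positivity), show a + b - 1 = (a - 1) + b by ring,
    Real.rpow_add ht, Real.one_rpow, one_mul]
  ring

theorem measureReal_gammaMeasure_Ioi {a x : ℝ} (ha : 0 < a) (hx : 0 ≤ x) :
    (gammaMeasure a 1).real (Ioi x) = incGamma a x / Real.Gamma a := by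
  simpa using setIntegral_rpow_gammaMeasure 0 ha hx

theorem measureReal_gammaMeasure_Iic {a x : ℝ} (ha : 0 < a) (hx : 0 ≤ x) :
    (gammaMeasure a 1).real (Iic x) = 1 - incGamma a x / Real.Gamma a := by
  have := isProbabilityMeasure_gammaMeasure ha one_pos
  rw [← compl_Ioi, probReal_compl_eq_one_sub measurableSet_Ioi, measureReal_gammaMeasure_Ioi ha hx]

theorem ae_pos_gammaMeasure (a r : ℝ) : ∀ᵐ x ∂(gammaMeasure a r), 0 < x := by
  have h : gammaMeasure a r (Iic 0) = 0 := by
    rw [← lintegral_indicator_one measurableSet_Iic,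
      lintegral_gammaMeasure (measurable_one.indicator measurableSet_Iic)]
    refine setLIntegral_eq_zero measurableSet_Ioi fun x (hx : 0 < x) => ?_
    rw [indicator_of_notMem (by simpa using hx), mul_zero, Pi.zero_apply]
  exact (measure_eq_zero_iff_ae_notMem.1 h).mono fun x hx => not_le.1 hx

theorem measureReal_mul_le_of_measureReal_Iic_le {c₁ c₂ x P g : ℝ} {ν : Measure ℝ} (hx : 0 ≤ x)
    (hP : 0 < P) (hν : ∀ t, 0 ≤ t → t < P → ν.real (Iic t) ≤ c₁ * t + c₂) (hg : x / P < g) :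
    ν.real {t | g * t ≤ x} ≤ c₁ * x * g ^ (-1 : ℝ) + c₂ := by
  have hg0 : 0 < g := (div_nonneg hx hP.le).trans_lt hg
  have hslice : {t | g * t ≤ x} = Iic (x / g) := by
    ext t
    simp only [mem_ofPred_eq, mem_Iic, le_div_iff₀' hg0]
  rw [hslice, Real.rpow_neg_one, mul_assoc, ← div_eq_mul_inv]
  exact hν _ (by positivity) ((div_lt_comm₀ hg0 hP).2 hg)

theorem integrableOn_mul_rpow_neg_one {γ : Measure ℝ} [IsFiniteMeasure γ] {x P : ℝ} (hx : 0 ≤ x)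
    (hP : 0 < P) : IntegrableOn (fun g => x * g ^ (-1 : ℝ)) (Ioi (x / P)) γ := by
  refine Integrable.of_bound (by fun_prop) P (ae_restrict_of_forall_mem measurableSet_Ioi ?_)
  intro g hg
  have hg0 : 0 < g := (div_nonneg hx hP.le).trans_lt hg
  rw [Real.rpow_neg_one, ← div_eq_mul_inv, Real.norm_of_nonneg (by positivity)]
  exact ((div_lt_comm₀ hg0 hP).2 hg).le

/-- Below the level `x / P` for the gamma variable nothing is assumed of `ν`; above it, the bound
on `ν` is integrated against the gamma law. -/
theorem measureReal_gammaMeasure_prod_mul_le {a c₁ c₂ x P : ℝ} {ν : Measure ℝ}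
    [IsProbabilityMeasure ν] (ha : 0 < a) (hx : 0 ≤ x) (hP : 0 < P)
    (hν : ∀ t, 0 ≤ t → t < P → ν.real (Iic t) ≤ c₁ * t + c₂) :
    ((gammaMeasure a 1).prod ν).real {z | z.1 * z.2 ≤ x} ≤
      1 - incGamma a (x / P) / Real.Gamma a
        + c₁ * x * (incGamma (a - 1) (x / P) / Real.Gamma a)
        + c₂ * (incGamma a (x / P) / Real.Gamma a) := by
  have := isProbabilityMeasure_gammaMeasure ha one_pos
  set γ := gammaMeasure a 1
  have hxP : 0 ≤ x / P := by positivity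
  have hs : MeasurableSet {z : ℝ × ℝ | z.1 * z.2 ≤ x} :=
    measurableSet_le (by fun_prop) measurable_const
  have integrable_slice : Integrable (fun g => ν.real {t | g * t ≤ x}) γ :=
    Measure.integrable_measure_prodMk_left hs (measure_ne_top _ _)
  have integrable_inv : IntegrableOn (fun g => c₁ * x * g ^ (-1 : ℝ)) (Ioi (x / P)) γ := by
    simpa only [mul_assoc, IntegrableOn] using (integrableOn_mul_rpow_neg_one hx hP).const_mul c₁
  calc (γ.prod ν).real {z | z.1 * z.2 ≤ x}
      = ∫ g, ν.real {t | g * t ≤ x} ∂γ := by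
        rw [measureReal_def, Measure.prod_apply hs, ← integral_toReal
          (measurable_measure_prodMk_left hs).aemeasurable
          (ae_of_all _ fun _ => measure_lt_top _ _)]
        rfl
    _ = (∫ g in Iic (x / P), ν.real {t | g * t ≤ x} ∂γ)
        + ∫ g in Ioi (x / P), ν.real {t | g * t ≤ x} ∂γ := by
        rw [← compl_Iic, integral_add_compl measurableSet_Iic integrable_slice]
    _ ≤ (∫ _ in Iic (x / P), 1 ∂γ) + ∫ g in Ioi (x / P), (c₁ * x * g ^ (-1 : ℝ) + c₂) ∂γ :=
        add_le_add
          (setIntegral_mono integrable_slice.integrableOn integrableOn_const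
            fun _ => measureReal_le_one)
          (setIntegral_mono_on integrable_slice.integrableOn
            (integrable_inv.add integrableOn_const) measurableSet_Ioi
            fun _ => measureReal_mul_le_of_measureReal_Iic_le hx hP hν)
    _ = _ := by
        rw [integral_add integrable_inv (integrable_const _), integral_const_mul,
          setIntegral_rpow_gammaMeasure _ ha hxP, setIntegral_const, setIntegral_const,
          measureReal_gammaMeasure_Ioi ha hxP, measureReal_gammaMeasure_Iic ha hxP, smul_eq_mul,
          smul_eq_mul, mul_one, ← sub_eq_add_neg]
        ring

end Gamma

section Exponential

open Set

variable {r : ℝ} (hr : 0 < r)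
include hr

theorem expMeasure_Iic_le (d : ℝ) : expMeasure r (Iic d) ≤ ENNReal.ofReal (r * d) := by
  have := isProbabilityMeasure_expMeasure hr
  rw [← ofReal_cdf, cdf_expMeasure_eq hr]
  refine ENNReal.ofReal_le_ofReal_iff'.2 ?_
  split_ifs with hd
  · left
    linarith [Real.add_one_le_exp (-(r * d))]
  · exact Or.inr le_rfl

theorem expMeasure_Ici {x : ℝ} (hx : 0 ≤ x) :
    expMeasure r (Ici x) = ENNReal.ofReal (Real.exp (-(r * x))) := by
  have := isProbabilityMeasure_expMeasure hr
  have h : Ioi x =ᵐ[expMeasure r] Ici x :=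
    (withDensity_absolutelyContinuous volume (gammaPDF 1 r)).ae_eq Ioi_ae_eq_Ici
  rw [← measure_congr h, ← compl_Iic, prob_compl_eq_one_sub measurableSet_Iic, ← ofReal_cdf,
    cdf_expMeasure_eq hr, if_pos hx, ← ENNReal.ofReal_one,
    ← ENNReal.ofReal_sub _ (sub_nonneg.2 (Real.exp_le_one_iff.2 (neg_nonpos.2 (by positivity)))),
    sub_sub_cancel]

theorem expMeasure_Ioc_ne_zero {x y : ℝ} (hx : 0 ≤ x) (hxy : x < y) :
    expMeasure r (Ioc x y) ≠ 0 := by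
  have := isProbabilityMeasure_expMeasure hr
  rw [← measure_cdf (expMeasure r), StieltjesFunction.measure_Ioc, cdf_expMeasure_eq hr,
    cdf_expMeasure_eq hr, if_pos hx, if_pos (hx.trans hxy.le), Ne, ENNReal.ofReal_eq_zero, not_le,
    sub_pos]
  gcongr

theorem map_sub_cond_expMeasure_Ici {a : ℝ} (ha : 0 ≤ a) :
    (cond (expMeasure r) (Ici a)).map (fun x => x - a) = expMeasure r := by
  have := isProbabilityMeasure_expMeasure hr
  refine Measure.ext_of_Ici _ _ fun x => ?_
  have preimage : (fun y => y - a) ⁻¹' Ici x = Ici (x + a) := by ext y; simp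
  rw [Measure.map_apply (by fun_prop) measurableSet_Ici, preimage, cond_apply measurableSet_Ici,
    Ici_inter_Ici]
  rcases le_total 0 x with hx | hx
  · rw [sup_eq_right.2 (by linarith), expMeasure_Ici hr ha, expMeasure_Ici hr hx,
      expMeasure_Ici hr (by positivity), ← ENNReal.ofReal_inv_of_pos (Real.exp_pos _),
      ← ENNReal.ofReal_mul (by positivity), ← Real.exp_neg, ← Real.exp_add]
    ring_nf
  · have full_mass : expMeasure r (Ici x) = 1 := by
      refine le_antisymm prob_le_one (le_trans (le_of_eq ?_) (measure_mono (Ici_subset_Ici.2 hx)))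
      simp [expMeasure_Ici hr le_rfl]
    rw [sup_eq_left.2 (by linarith), full_mass, expMeasure_Ici hr ha,
      ENNReal.inv_mul_cancel (by simp [Real.exp_pos]) ENNReal.ofReal_ne_top]

theorem map_div_expMeasure_prod_Iic_le {ρ : Measure ℝ} [SFinite ρ] (hρ : ∀ᵐ w ∂ρ, 0 < w)
    {t : ℝ} (ht : 0 ≤ t) :
    ((expMeasure r).prod ρ).map (fun z => z.1 / z.2) (Iic t) ≤
      ENNReal.ofReal (r * t) * ∫⁻ w, ENNReal.ofReal w ∂ρ := by
  have := isProbabilityMeasure_expMeasure hr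
  rw [Measure.map_apply (by fun_prop) measurableSet_Iic,
    Measure.prod_apply_symm (measurableSet_Iic.preimage (by fun_prop)),
    ← lintegral_const_mul _ (by fun_prop)]
  refine lintegral_mono_ae (hρ.mono fun w hw => ?_)
  have slice : (fun x => (x, w)) ⁻¹' ((fun z : ℝ × ℝ => z.1 / z.2) ⁻¹' Iic t) = Iic (t * w) := by
    ext x
    simp only [mem_preimage, mem_Iic, div_le_iff₀ hw]
  rw [slice, ← ENNReal.ofReal_mul (by positivity), mul_assoc]
  exact expMeasure_Iic_le hr _

theorem map_div_expMeasure_prod_Ioc_ne_zero {ρ : Measure ℝ} [SFinite ρ] [NeZero ρ]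
    (hρ : ∀ᵐ w ∂ρ, 0 < w) {s t : ℝ} (hs : 0 ≤ s) (hst : s < t) :
    ((expMeasure r).prod ρ).map (fun z => z.1 / z.2) (Ioc s t) ≠ 0 := by
  have := isProbabilityMeasure_expMeasure hr
  have hm : MeasurableSet ((fun z : ℝ × ℝ => z.1 / z.2) ⁻¹' Ioc s t) :=
    measurableSet_Ioc.preimage (by fun_prop)
  rw [Measure.map_apply (by fun_prop) measurableSet_Ioc, Measure.prod_apply_symm hm, Ne,
    lintegral_eq_zero_iff (measurable_measure_prodMk_right hm)]
  intro ae_slice_null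
  obtain ⟨w, hw, slice_null⟩ := (hρ.and ae_slice_null).exists
  have slice : (fun x => (x, w)) ⁻¹' ((fun z : ℝ × ℝ => z.1 / z.2) ⁻¹' Ioc s t) =
      Ioc (s * w) (t * w) := by
    ext x
    simp only [mem_preimage, mem_Ioc, lt_div_iff₀ hw, div_le_iff₀ hw]
  refine expMeasure_Ioc_ne_zero hr (x := s * w) (y := t * w) (by positivity) (by gcongr) ?_
  rw [← slice]
  exact slice_null

end Exponential

section Independence

variable {Ω α β γ : Type*} [MeasurableSpace Ω] [MeasurableSpace α] [MeasurableSpace β]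
  [MeasurableSpace γ] {μ : Measure Ω} [IsProbabilityMeasure μ]

theorem indepFun_comp_of_indepFun_map {δ : Type*} [MeasurableSpace δ] {X : Ω → α} {f : α → β}
    {g : α → δ} (hX : Measurable X) (hf : Measurable f) (hg : Measurable g)
    (h : IndepFun f g (μ.map X)) : IndepFun (f ∘ X) (g ∘ X) μ := by
  have := Measure.isProbabilityMeasure_map (μ := μ) hX.aemeasurable
  rw [indepFun_iff_map_prod_eq_prod_map_map (by fun_prop) (by fun_prop)] at h ⊢
  rw [← Measure.map_map hf hX, ← Measure.map_map hg hX, ← h,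
    Measure.map_map (by fun_prop) hX]
  rfl

theorem indepFun_prodMk_of_indepFun_prodMk {X : Ω → α} {Y : Ω → β} {Z : Ω → γ}
    (hX : Measurable X) (hY : Measurable Y) (hZ : Measurable Z) (hXY : IndepFun X Y μ)
    (hXYZ : IndepFun (fun ω => (X ω, Y ω)) Z μ) : IndepFun X (fun ω => (Y ω, Z ω)) μ := by
  have hYZ : IndepFun Y Z μ := hXYZ.comp measurable_snd measurable_id
  have := Measure.isProbabilityMeasure_map (μ := μ) hX.aemeasurable
  have := Measure.isProbabilityMeasure_map (μ := μ) hY.aemeasurable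
  have := Measure.isProbabilityMeasure_map (μ := μ) hZ.aemeasurable
  rw [indepFun_iff_map_prod_eq_prod_map_map (by fun_prop) (by fun_prop)] at hXY hYZ hXYZ ⊢
  rw [hYZ, ← Measure.prodAssoc_prod, ← hXY, ← hXYZ, Measure.map_map (by fun_prop) (by fun_prop)]
  rfl

theorem map_prodMk_cond_of_indepFun {X : Ω → α} {Y : Ω → β} (hX : Measurable X)
    (hY : Measurable Y) (hXY : IndepFun X Y μ) {s : Set α} (hs : MeasurableSet s) :
    (cond μ (X ⁻¹' s)).map (fun ω => (X ω, Y ω)) = (cond (μ.map X) s).prod (μ.map Y) := by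
  have := Measure.isProbabilityMeasure_map (μ := μ) hX.aemeasurable
  have := Measure.isProbabilityMeasure_map (μ := μ) hY.aemeasurable
  have preimage : X ⁻¹' s = (fun ω => (X ω, Y ω)) ⁻¹' (s ×ˢ Set.univ) := by ext; simp
  rw [ProbabilityTheory.cond, ProbabilityTheory.cond, Measure.map_smul, Measure.prod_smul_left,
    Measure.map_apply hX hs]
  congr 1
  rw [preimage, ← Measure.restrict_map (hX.prodMk hY) (hs.prod .univ),
    (indepFun_iff_map_prod_eq_prod_map_map (by fun_prop) (by fun_prop)).1 hXY,
    ← Measure.prod_restrict, Measure.restrict_univ]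

theorem map_prodMk_eq_prod_of_ae_map_eq {D : Ω → α} {h : Ω → β} {F : α × β → γ} {κ : Measure γ}
    [SigmaFinite κ] (hD : Measurable D) (hh : Measurable h) (hF : Measurable F)
    (hDh : IndepFun D h μ) (hκ : ∀ᵐ d ∂(μ.map D), (μ.map h).map (fun x => F (d, x)) = κ) :
    μ.map (fun ω => (D ω, F (D ω, h ω))) = (μ.map D).prod κ := by
  have := Measure.isProbabilityMeasure_map (μ := μ) hD.aemeasurable
  have := Measure.isProbabilityMeasure_map (μ := μ) hh.aemeasurable
  refine (Measure.prod_eq fun s t hs ht => ?_).symm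
  have hm : Measurable fun z : α × β => (z.1, F z) := by fun_prop
  have hcomp : (fun ω => (D ω, F (D ω, h ω))) = (fun z => (z.1, F z)) ∘ fun ω => (D ω, h ω) := rfl
  rw [hcomp, ← Measure.map_map hm (by fun_prop),
    (indepFun_iff_map_prod_eq_prod_map_map (by fun_prop) (by fun_prop)).1 hDh,
    Measure.map_apply hm (hs.prod ht), Measure.prod_apply (hm (hs.prod ht))]
  calc ∫⁻ d, μ.map h (Prod.mk d ⁻¹' ((fun z => (z.1, F z)) ⁻¹' s ×ˢ t)) ∂(μ.map D)
      = ∫⁻ d, s.indicator (fun _ => κ t) d ∂(μ.map D) := by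
        refine lintegral_congr_ae (hκ.mono fun d hd => ?_)
        by_cases hds : d ∈ s
        · simp [hds, ← hd, Measure.map_apply (show Measurable fun x => F (d, x) by fun_prop) ht,
            Set.preimage_preimage, Set.mk_preimage_prod]
        · simp [hds, Set.preimage_preimage, Set.mk_preimage_prod]
    _ = μ.map D s * κ t := by rw [lintegral_indicator_const hs, mul_comm]

end Independence

theorem lintegral_id_of_measureReal_Iic_eq_div_pow {ν : Measure ℝ} [IsProbabilityMeasure ν]
    {T : ℝ} {n : ℕ} (hT : 0 < T) (hn : n ≠ 0)
    (hν : ∀ τ, 0 ≤ τ → τ ≤ T → ν.real (Set.Iic τ) = (τ / T) ^ n) :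
    ∫⁻ x, ENNReal.ofReal x ∂ν = ENNReal.ofReal (n / (n + 1) * T) := by
  have ae_pos : ∀ᵐ x ∂ν, 0 < x := by
    have h : ν.real (Set.Iic 0) = 0 := by simp [hν 0 le_rfl hT.le, hn]
    rw [measureReal_eq_zero_iff, measure_eq_zero_iff_ae_notMem] at h
    exact h.mono fun x hx => not_le.1 hx
  have tail : ∀ t ∈ Set.Ioi (0 : ℝ),
      ν (Set.Ioi t) = (Set.Iic T).indicator (fun t => ENNReal.ofReal (1 - (t / T) ^ n)) t := by
    intro t ht
    have ht : 0 < t := ht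
    have hIoi : ν (Set.Ioi t) = ENNReal.ofReal (1 - ν.real (Set.Iic t)) := by
      rw [← probReal_compl_eq_one_sub measurableSet_Iic, Set.compl_Iic, ofReal_measureReal]
    rcases le_or_gt t T with htT | htT
    · rw [hIoi, hν t ht.le htT, Set.indicator_of_mem (Set.mem_Iic.2 htT)]
    · have full_mass : 1 ≤ ν.real (Set.Iic t) := by
        calc 1 = ν.real (Set.Iic T) := by simp [hν T hT.le le_rfl, hT.ne']
          _ ≤ ν.real (Set.Iic t) := measureReal_mono (Set.Iic_subset_Iic.2 htT.le)
      rw [hIoi, Set.indicator_of_notMem (by simpa using htT),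
        ENNReal.ofReal_of_nonpos (by linarith)]
  calc ∫⁻ x, ENNReal.ofReal x ∂ν = ∫⁻ t in Set.Ioi 0, ν (Set.Ioi t) :=
        lintegral_eq_lintegral_meas_lt ν (ae_pos.mono fun _ h => h.le) measurable_id.aemeasurable
    _ = ∫⁻ t in Set.Ioc 0 T, ENNReal.ofReal (1 - (t / T) ^ n) := by
        rw [setLIntegral_congr_fun measurableSet_Ioi tail, setLIntegral_indicator measurableSet_Iic,
          Set.inter_comm, Set.Ioi_inter_Iic]
    _ = ENNReal.ofReal (∫ t in 0..T, (1 - (t / T) ^ n)) := by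
        rw [intervalIntegral.integral_of_le hT.le, ofReal_integral_eq_lintegral_ofReal
          (Continuous.integrableOn_Ioc (by fun_prop))]
        refine ae_restrict_of_forall_mem measurableSet_Ioc fun t ht => sub_nonneg.2 ?_
        exact pow_le_one₀ (div_nonneg ht.1.le hT.le) ((div_le_one hT).2 ht.2)
    _ = ENNReal.ofReal (n / (n + 1) * T) := by
        congr 1
        rw [intervalIntegral.integral_sub (by simp)
          (Continuous.intervalIntegrable (by fun_prop) _ _),
          intervalIntegral.integral_comp_div (fun t => t ^ n) hT.ne']
        simp only [intervalIntegral.integral_const, integral_pow, sub_zero, zero_div,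
          div_self hT.ne', smul_eq_mul, one_pow, mul_one]
        field_simp
        ring

section Codebook

open Set Channel

variable {A : ℕ} {p p' : ℕ → ℝ}

theorem codebookFloor_congr (h : ∀ k < 2 ^ A, p k = p' k) :
    codebookFloor A p = codebookFloor A p' := by
  have : p '' Iio (2 ^ A) = p' '' Iio (2 ^ A) := image_congr fun k hk => h k hk
  funext x
  rw [codebookFloor, codebookFloor, this]

/-- The codebook `0 = p 0 < p 1 < ⋯ < p (2 ^ A - 1)` that cuts `(0, ∞)` into cells of equal
`ν`-probability. This is `Channel.IsCodebook` for the law `ν` of the quantized signal itself, freed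
from the channel model; as there, the values of `p` at larger indices are irrelevant. -/
structure IsEqualProbabilityCodebook (ν : Measure ℝ) (A : ℕ) (p : ℕ → ℝ) : Prop where
  zero : p 0 = 0
  strictMono : StrictMonoOn p (Iio (2 ^ A))
  cell : ∀ n, n + 1 < 2 ^ A → ν.real (Ioc (p n) (p (n + 1))) = 1 / (2 : ℝ) ^ A
  last : ν.real (Ioi (p (2 ^ A - 1))) = 1 / (2 : ℝ) ^ A

namespace IsEqualProbabilityCodebook

variable {ν : Measure ℝ} (h : IsEqualProbabilityCodebook ν A p)
include h

theorem nonneg {k : ℕ} (hk : k < 2 ^ A) : 0 ≤ p k := by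
  rw [← h.zero]
  exact h.strictMono.monotoneOn (mem_Iio.2 (by positivity)) hk (Nat.zero_le k)

theorem codebookFloor_nonneg (x : ℝ) : 0 ≤ codebookFloor A p x := by
  refine Real.sSup_nonneg ?_
  rintro _ ⟨⟨k, hk, rfl⟩, -⟩
  exact h.nonneg hk

theorem monotone_codebookFloor : Monotone (codebookFloor A p) := by
  intro x y hxy
  rcases lt_or_ge x 0 with hx | hx
  · have empty : p '' Iio (2 ^ A) ∩ Iic x = ∅ := by
      rw [eq_empty_iff_forall_notMem]
      rintro _ ⟨⟨k, hk, rfl⟩, hkx⟩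
      exact (hx.trans_le (h.nonneg hk)).not_ge hkx
    rw [codebookFloor, empty, Real.sSup_empty]
    exact h.codebookFloor_nonneg y
  · refine csSup_le_csSup ⟨y, fun _ hz => hz.2⟩ ?_
      (inter_subset_inter_right _ (Iic_subset_Iic.2 hxy))
    exact ⟨p 0, mem_image_of_mem p (mem_Iio.2 (by positivity)), h.zero.trans_le hx⟩

/-- Rounding down to the codebook moves a value across `t` only inside the cell containing `t`. -/
theorem exists_cell_of_codebookFloor_le {t : ℝ} (ht : 0 ≤ t) :
    ∃ k < 2 ^ A, ∀ x, codebookFloor A p x ≤ t →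
      x ≤ t ∨ (p k < x ∧ (k + 1 < 2 ^ A → x ≤ p (k + 1))) := by
  have hA : 0 < 2 ^ A := by positivity
  set k := Nat.findGreatest (fun k => p k ≤ t) (2 ^ A - 1)
  have hkt : p k ≤ t :=
    Nat.findGreatest_spec (P := fun k => p k ≤ t) (Nat.zero_le _) (h.zero.trans_le ht)
  have hkA : k ≤ 2 ^ A - 1 := Nat.findGreatest_le _
  refine ⟨k, by omega, fun x hx => (le_or_gt x t).imp_right fun hxt =>
    ⟨hkt.trans_lt hxt, fun hk1 => ?_⟩⟩
  by_contra! hlt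
  have next_le : p (k + 1) ≤ t :=
    (le_csSup (s := p '' Iio (2 ^ A) ∩ Iic x) ⟨x, fun _ hy => hy.2⟩
      ⟨mem_image_of_mem p hk1, hlt.le⟩).trans hx
  have := Nat.le_findGreatest (P := fun k => p k ≤ t) (n := 2 ^ A - 1) (by omega) next_le
  omega

theorem measureReal_codebookFloor_le [IsFiniteMeasure ν] {t : ℝ} (ht : 0 ≤ t) :
    ν.real {x | codebookFloor A p x ≤ t} ≤ ν.real (Iic t) + 1 / (2 : ℝ) ^ A := by
  obtain ⟨k, hk, hcell⟩ := h.exists_cell_of_codebookFloor_le ht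
  obtain ⟨s, hs, hcover⟩ : ∃ s, ν.real s = 1 / (2 : ℝ) ^ A ∧
      {x | codebookFloor A p x ≤ t} ⊆ Iic t ∪ s := by
    rcases Nat.lt_or_ge (k + 1) (2 ^ A) with hk1 | hk1
    · exact ⟨Ioc (p k) (p (k + 1)), h.cell k hk1,
        fun x hx => (hcell x hx).imp_right fun hxk => ⟨hxk.1, hxk.2 hk1⟩⟩
    · obtain rfl : k = 2 ^ A - 1 := by omega
      exact ⟨Ioi (p (2 ^ A - 1)), h.last, fun x hx => (hcell x hx).imp_right And.left⟩
  exact (measureReal_mono hcover).trans (hs ▸ measureReal_union_le _ _)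

theorem succ_le_succ_of_eq [IsFiniteMeasure ν] (h' : IsEqualProbabilityCodebook ν A p')
    (hν : ∀ s t, 0 ≤ s → s < t → ν (Ioc s t) ≠ 0) {n : ℕ} (hn : n + 1 < 2 ^ A)
    (hpn : p n = p' n) : p (n + 1) ≤ p' (n + 1) := by
  by_contra! hlt
  have hmono : p' n ≤ p' (n + 1) :=
    h'.strictMono.monotoneOn (mem_Iio.2 (by omega)) (mem_Iio.2 hn) n.le_succ
  have hsplit := measureReal_union (μ := ν) (Ioc_disjoint_Ioc_of_le (a := p' n)
    (le_refl (p' (n + 1))) (d := p (n + 1))) measurableSet_Ioc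
  rw [Ioc_union_Ioc_eq_Ioc hmono hlt.le, h'.cell n hn, ← hpn, h.cell n hn, left_eq_add,
    measureReal_eq_zero_iff] at hsplit
  exact hν _ _ (h'.nonneg hn) hlt hsplit

theorem eq_of_forall_Ioc_ne_zero [IsFiniteMeasure ν] (h' : IsEqualProbabilityCodebook ν A p')
    (hν : ∀ s t, 0 ≤ s → s < t → ν (Ioc s t) ≠ 0) {k : ℕ} (hk : k < 2 ^ A) : p k = p' k := by
  induction k with
  | zero => rw [h.zero, h'.zero]
  | succ n ih =>
    have hpn := ih (by omega)
    exact le_antisymm (h.succ_le_succ_of_eq h' hν hk hpn) (h'.succ_le_succ_of_eq h hν hk hpn.symm)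

end IsEqualProbabilityCodebook

end Codebook

@[fun_prop]
theorem measurable_shape {L : ℕ} : Measurable (shape : Vec L → Vec L) := by
  unfold shape
  fun_prop

theorem measurable_quantError {α : Type*} [MeasurableSpace α] {L : ℕ} {u s : α → Vec L}
    (hu : Measurable u) (hs : Measurable s) : Measurable fun a => quantError (u a) (s a) := by
  unfold quantError
  fun_prop

namespace Params

variable (S : Params)

theorem L_sub_one_pos : (0 : ℝ) < (S.L : ℝ) - 1 :=
  sub_pos.2 (Nat.one_lt_cast.2 S.one_lt_L)

theorem natCast_L_sub_one : ((S.L - 1 : ℕ) : ℝ) = (S.L : ℝ) - 1 := by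
  rw [Nat.cast_sub S.one_lt_L.le, Nat.cast_one]

/-- The smallest primary channel gain `θ_p / γ_p` that avoids a primary outage. -/
def gainThreshold : ℝ := S.thetaP / S.gammaP

theorem gainThreshold_pos : 0 < S.gainThreshold := div_pos S.thetaP_pos S.gammaP_pos

/-- The largest possible CDI quantization error `2 ^ (-B / (L - 1))`. -/
def maxQuantError : ℝ := (2 : ℝ) ^ (-((S.B : ℝ) / ((S.L : ℝ) - 1)))

theorem maxQuantError_pos : 0 < S.maxQuantError := Real.rpow_pos_of_pos two_pos _

theorem two_pow_mul_pow_eq_div_maxQuantError_pow (τ : ℝ) :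
    (2 : ℝ) ^ S.B * τ ^ (S.L - 1) = (τ / S.maxQuantError) ^ (S.L - 1) := by
  have maxQuantError_pow : S.maxQuantError ^ (S.L - 1) = ((2 : ℝ) ^ S.B)⁻¹ := by
    rw [maxQuantError, ← Real.rpow_natCast, ← Real.rpow_mul two_pos.le, natCast_L_sub_one, neg_mul,
      div_mul_cancel₀ _ S.L_sub_one_pos.ne', Real.rpow_neg two_pos.le, Real.rpow_natCast]
  rw [div_pow, maxQuantError_pow, div_inv_eq_mul, mul_comm]

/-- The mean of the gain penalty, `θ_p λ (L - 1) 2 ^ (-B / (L - 1)) / (γ_p σ²)`. -/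
def meanGainPenalty : ℝ :=
  S.gainThreshold / S.sigma2 * (S.lam * ((S.L : ℝ) - 1) * S.maxQuantError)

theorem meanGainPenalty_pos : 0 < S.meanGainPenalty :=
  mul_pos (div_pos S.gainThreshold_pos S.sigma2_pos)
    (mul_pos (mul_pos S.lam_pos S.L_sub_one_pos) S.maxQuantError_pos)

theorem nontrivial_vec : Nontrivial (Vec S.L) :=
  have : Nonempty (Fin S.L) := ⟨⟨0, zero_lt_one.trans S.one_lt_L⟩⟩
  inferInstance

end Params

namespace Channel

section Gains

variable {S : Params} {Ω : Type*} [MeasurableSpace Ω] {μ : Measure Ω}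
  {V : Type*} [MeasurableSpace V] (C : Channel S μ V)

/-- The interference gain `λ g_x ε`: an orthogonal beamformer of power `P` causes interference at
most `P` times this at the primary receiver. -/
def interferenceGain (ω : Ω) : ℝ := S.lam * C.gx ω * C.eps ω

/-- The squared length of the component of `h_s` orthogonal to the quantized CDI. -/
def residualGain (ω : Ω) : ℝ := ‖C.hs ω‖ ^ 2 - ‖inner ℂ (C.sxhat ω) (C.hs ω)‖ ^ 2

theorem interferenceGain_eq (ω : Ω) : C.interferenceGain ω = ‖C.hx ω‖ ^ 2 * C.eps ω := by
  rw [interferenceGain, gx, mul_div_cancel₀ _ S.lam_pos.ne']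

theorem measurable_hp_hx_seed : Measurable fun ω => (C.hp ω, C.hx ω, C.seed ω) :=
  C.measurable_hp.prodMk (C.measurable_hx.prodMk C.measurable_seed)

@[fun_prop]
theorem measurable_gp : Measurable C.gp := C.measurable_hp.norm.pow_const 2

theorem measurable_sx : Measurable C.sx := measurable_shape.comp C.measurable_hx

theorem measurable_sxhat : Measurable C.sxhat :=
  C.measurable_quantizer.comp (C.measurable_sx.prodMk C.measurable_seed)

theorem measurable_eps : Measurable C.eps :=
  measurable_quantError C.measurable_sxhat C.measurable_sx

theorem exists_measurable_interferenceGain_eq :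
    ∃ F : Vec S.L × V → ℝ, Measurable F ∧ ∀ ω, C.interferenceGain ω = F (C.hx ω, C.seed ω) := by
  have h₁ : Measurable fun d : Vec S.L × V => shape d.1 := measurable_shape.comp measurable_fst
  have h₂ : Measurable fun d : Vec S.L × V => C.quantizer (shape d.1, d.2) :=
    C.measurable_quantizer.comp (h₁.prodMk measurable_snd)
  exact ⟨fun d => ‖d.1‖ ^ 2 * quantError (C.quantizer (shape d.1, d.2)) (shape d.1),
    (measurable_fst.norm.pow_const 2).mul (measurable_quantError h₂ h₁),
    C.interferenceGain_eq⟩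

@[fun_prop]
theorem measurable_interferenceGain : Measurable C.interferenceGain := by
  obtain ⟨F, hF, hCF⟩ := C.exists_measurable_interferenceGain_eq
  rw [funext hCF]
  exact hF.comp (C.measurable_hx.prodMk C.measurable_seed)

@[fun_prop]
theorem measurable_residualGain : Measurable C.residualGain :=
  (C.measurable_hs.norm.pow_const 2).sub
    ((C.measurable_sxhat.inner C.measurable_hs).norm.pow_const 2)

theorem map_gp : μ.map C.gp = expMeasure 1 := by
  have h := (isRadialGaussian_complexGaussian one_pos).map_norm_sq one_pos
  rw [← C.law_hp.map_eq, Measure.map_map (by fun_prop) C.measurable_hp,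
    Complex.finrank_real_complex, Nat.cast_ofNat, div_self two_ne_zero, inv_one] at h
  exact h

theorem indepFun_gp_interferenceGain : IndepFun C.gp C.interferenceGain μ := by
  obtain ⟨F, hF, hCF⟩ := C.exists_measurable_interferenceGain_eq
  rw [funext hCF]
  exact C.indep_hp.comp (by fun_prop : Measurable fun z : ℂ => ‖z‖ ^ 2) hF

theorem measureReal_eps_le {τ : ℝ} (h₀ : 0 ≤ τ) (h₁ : τ ≤ S.maxQuantError) :
    (μ.map C.eps).real (Set.Iic τ) = (τ / S.maxQuantError) ^ (S.L - 1) := by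
  rw [map_measureReal_apply C.measurable_eps measurableSet_Iic,
    ← S.two_pow_mul_pow_eq_div_maxQuantError_pow, ← C.quantError_cdf τ h₀ h₁]
  rfl

variable [IsProbabilityMeasure μ]

theorem isRadialGaussian_map_hx : IsRadialGaussian (μ.map C.hx) S.lam :=
  C.law_hx.isRadialGaussian S.lam_pos C.measurable_hx

theorem ae_eps_pos : ∀ᵐ ω ∂μ, 0 < C.eps ω := by
  have h := C.measureReal_eps_le le_rfl S.maxQuantError_pos.le
  rw [zero_div, zero_pow (Nat.sub_pos_of_lt S.one_lt_L).ne', measureReal_eq_zero_iff,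
    measure_eq_zero_iff_ae_notMem] at h
  exact (ae_of_ae_map C.measurable_eps.aemeasurable h).mono fun ω hω => not_le.1 hω

theorem lintegral_eps :
    ∫⁻ ω, ENNReal.ofReal (C.eps ω) ∂μ =
      ENNReal.ofReal (((S.L : ℝ) - 1) / S.L * S.maxQuantError) := by
  have := Measure.isProbabilityMeasure_map (μ := μ) C.measurable_eps.aemeasurable
  rw [← lintegral_map (f := ENNReal.ofReal) (by fun_prop) C.measurable_eps,
    lintegral_id_of_measureReal_Iic_eq_div_pow S.maxQuantError_pos
      (Nat.sub_pos_of_lt S.one_lt_L).ne' fun τ => C.measureReal_eps_le,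
    S.natCast_L_sub_one, sub_add_cancel]

theorem map_norm_hx_sq : μ.map (fun ω => ‖C.hx ω‖ ^ 2) = gammaMeasure S.L S.lam⁻¹ := by
  have := S.nontrivial_vec
  have := Measure.isProbabilityMeasure_map (μ := μ) C.measurable_hx.aemeasurable
  have h := C.isRadialGaussian_map_hx.map_norm_sq S.lam_pos
  rw [Measure.map_map (by fun_prop) C.measurable_hx, finrank_real_of_complex,
    finrank_euclideanSpace_fin, Nat.cast_mul, Nat.cast_ofNat, mul_div_cancel_left₀ _ two_ne_zero]
    at h
  exact h

/-- The length of `h_x` is independent of its direction and of the seed, which together determine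
the quantization error. -/
theorem indepFun_norm_hx_sq_eps : IndepFun (fun ω => ‖C.hx ω‖ ^ 2) C.eps μ := by
  have := S.nontrivial_vec
  have := Measure.isProbabilityMeasure_map (μ := μ) C.measurable_hx.aemeasurable
  have norm_sx : IndepFun (fun ω => ‖C.hx ω‖ ^ 2) C.sx μ := by
    have h := C.isRadialGaussian_map_hx.indepFun_norm_sq_direction S.lam_pos
    simp only [← Complex.coe_smul] at h
    exact indepFun_comp_of_indepFun_map C.measurable_hx (by fun_prop) measurable_shape h
  have norm_sx_seed : IndepFun (fun ω => ‖C.hx ω‖ ^ 2) (fun ω => (C.sx ω, C.seed ω)) μ :=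
    indepFun_prodMk_of_indepFun_prodMk (C.measurable_hx.norm.pow_const 2) C.measurable_sx
      C.measurable_seed norm_sx (C.indep_hx.comp
        (by fun_prop : Measurable fun x : Vec S.L => (‖x‖ ^ 2, shape x)) measurable_id)
  exact norm_sx_seed.comp measurable_id
    (measurable_quantError C.measurable_quantizer measurable_fst)

theorem lintegral_interferenceGain :
    ∫⁻ ω, ENNReal.ofReal (C.interferenceGain ω) ∂μ =
      ENNReal.ofReal (S.lam * ((S.L : ℝ) - 1) * S.maxQuantError) := by
  have hL : (0 : ℝ) < S.L := Nat.cast_pos.2 (zero_lt_one.trans S.one_lt_L)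
  have mean_norm : ∫⁻ ω, ENNReal.ofReal (‖C.hx ω‖ ^ 2) ∂μ = ENNReal.ofReal (S.L / S.lam⁻¹) := by
    rw [← lintegral_id_gammaMeasure hL (inv_pos.2 S.lam_pos), ← C.map_norm_hx_sq,
      lintegral_map (by fun_prop) (C.measurable_hx.norm.pow_const 2)]
  have indep : IndepFun (fun ω => ENNReal.ofReal (‖C.hx ω‖ ^ 2))
      (fun ω => ENNReal.ofReal (C.eps ω)) μ :=
    C.indepFun_norm_hx_sq_eps.comp ENNReal.measurable_ofReal ENNReal.measurable_ofReal
  calc ∫⁻ ω, ENNReal.ofReal (C.interferenceGain ω) ∂μ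
      = ∫⁻ ω, ENNReal.ofReal (‖C.hx ω‖ ^ 2) * ENNReal.ofReal (C.eps ω) ∂μ := by
        simp only [C.interferenceGain_eq, ENNReal.ofReal_mul (sq_nonneg _)]
    _ = ENNReal.ofReal (S.L / S.lam⁻¹)
          * ENNReal.ofReal (((S.L : ℝ) - 1) / S.L * S.maxQuantError) := by
        rw [← mean_norm, ← C.lintegral_eps]
        exact lintegral_mul_eq_lintegral_mul_lintegral_of_indepFun
          (C.measurable_hx.norm.pow_const 2).ennreal_ofReal C.measurable_eps.ennreal_ofReal indep
    _ = ENNReal.ofReal (S.lam * ((S.L : ℝ) - 1) * S.maxQuantError) := by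
        rw [← ENNReal.ofReal_mul (div_pos hL (inv_pos.2 S.lam_pos)).le]
        congr 1
        field_simp

theorem ae_interferenceGain_pos : ∀ᵐ ω ∂μ, 0 < C.interferenceGain ω := by
  have norm_pos : ∀ᵐ ω ∂μ, 0 < ‖C.hx ω‖ ^ 2 := by
    have h := ae_pos_gammaMeasure S.L S.lam⁻¹
    rw [← C.map_norm_hx_sq] at h
    exact ae_of_ae_map (C.measurable_hx.norm.pow_const 2).aemeasurable h
  filter_upwards [norm_pos, C.ae_eps_pos] with ω hx heps
  exact C.interferenceGain_eq ω ▸ mul_pos hx heps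

end Gains

end Channel

namespace Channel

section PowerControl

variable {S : Params} {Ω : Type*} [MeasurableSpace Ω] {μ : Measure Ω}
  {V : Type*} [MeasurableSpace V] (C : Channel S μ V)

/-- The largest power `margin / (λ g_x ε)` whose interference the primary receiver tolerates. It is
the IPC signal `η` whenever the primary link is not in outage, and unlike `η` it does not involve
`Pmax`. -/
def powerCap (ω : Ω) : ℝ := C.margin ω / C.interferenceGain ω

/-- The interference gain in units of the primary gain: an orthogonal beamformer of power `P` raises
the gain that the primary link needs by at most `P` times this. -/
def gainPenalty (ω : Ω) : ℝ := S.gainThreshold / S.sigma2 * C.interferenceGain ω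

/-- The law of the power cap given that the primary link is not in outage. -/
def capLaw : Measure ℝ := (cond μ C.noPrimaryOutage).map C.powerCap

theorem margin_eq (ω : Ω) :
    C.margin ω = (C.gp ω - S.gainThreshold) / (S.gainThreshold / S.sigma2) := by
  have := S.gammaP_pos.ne'
  have := S.thetaP_pos.ne'
  have := S.sigma2_pos.ne'
  rw [margin, Params.gainThreshold]
  field_simp

theorem powerCap_eq (ω : Ω) :
    C.powerCap ω = (C.gp ω - S.gainThreshold) / C.gainPenalty ω := by
  rw [powerCap, margin_eq, div_div, gainPenalty]

theorem noPrimaryOutage_eq : C.noPrimaryOutage = C.gp ⁻¹' Set.Ici S.gainThreshold := by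
  ext ω
  exact (div_le_iff₀' S.gammaP_pos).symm

theorem margin_nonneg_iff {ω : Ω} : 0 ≤ C.margin ω ↔ ω ∈ C.noPrimaryOutage := by
  rw [margin_eq, le_div_iff₀ (div_pos S.gainThreshold_pos S.sigma2_pos), zero_mul, sub_nonneg,
    noPrimaryOutage_eq]
  rfl

theorem eta_of_mem_noPrimaryOutage (Pmax : ℝ) {ω : Ω} (hω : ω ∈ C.noPrimaryOutage) :
    C.eta Pmax ω = C.powerCap ω :=
  if_pos (C.margin_nonneg_iff.2 hω)

open Classical in
theorem etahat_eq (Pmax : ℝ) (p : ℕ → ℝ) (ω : Ω) : C.etahat Pmax p ω =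
    if ω ∈ C.noPrimaryOutage ∧ C.powerCap ω < Pmax then codebookFloor S.A p (C.powerCap ω)
    else Pmax := by
  by_cases hω : ω ∈ C.noPrimaryOutage
  · simp only [etahat, margin_nonneg_iff, C.eta_of_mem_noPrimaryOutage Pmax hω]
  · simp only [etahat, margin_nonneg_iff, hω, false_and, if_false]

@[fun_prop]
theorem measurable_gainPenalty : Measurable C.gainPenalty :=
  C.measurable_interferenceGain.const_mul _

theorem measurable_powerCap : Measurable C.powerCap := by
  rw [funext C.powerCap_eq]
  fun_prop

theorem measurableSet_noPrimaryOutage : MeasurableSet C.noPrimaryOutage :=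
  C.noPrimaryOutage_eq ▸ C.measurable_gp measurableSet_Ici

theorem measureReal_noPrimaryOutage :
    μ.real C.noPrimaryOutage = Real.exp (-S.gainThreshold) := by
  rw [noPrimaryOutage_eq, ← map_measureReal_apply C.measurable_gp measurableSet_Ici,
    measureReal_def, C.map_gp, expMeasure_Ici one_pos S.gainThreshold_pos.le, one_mul,
    ENNReal.toReal_ofReal (Real.exp_pos _).le]

instance : IsFiniteMeasure C.capLaw := by
  unfold capLaw
  infer_instance

theorem IsCodebook.isEqualProbabilityCodebook {C : Channel S μ V} {Pmax : ℝ}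
    {p : ℕ → ℝ} (hp : C.IsCodebook Pmax p) : IsEqualProbabilityCodebook C.capLaw S.A p := by
  have real_capLaw : ∀ s, MeasurableSet s → C.capLaw.real s =
      (cond μ C.noPrimaryOutage).real {ω | C.eta Pmax ω ∈ s} := fun s hs => by
    rw [capLaw, map_measureReal_apply C.measurable_powerCap hs]
    refine measureReal_congr ?_
    filter_upwards [ae_cond_mem C.measurableSet_noPrimaryOutage] with ω hω
    exact congrArg (· ∈ s) (C.eta_of_mem_noPrimaryOutage Pmax hω).symm
  exact {
    zero := hp.zero
    strictMono := hp.strictMono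
    cell n hn := (real_capLaw _ measurableSet_Ioc).trans (hp.cell n hn)
    last := (real_capLaw _ measurableSet_Ioi).trans hp.last }

theorem etahat_nonneg {Pmax : ℝ} (hP : 0 ≤ Pmax) {p : ℕ → ℝ}
    (hp : IsEqualProbabilityCodebook C.capLaw S.A p) (ω : Ω) : 0 ≤ C.etahat Pmax p ω := by
  classical
  rw [etahat_eq]
  split_ifs
  exacts [hp.codebookFloor_nonneg _, hP]

theorem exists_measurable_etahat_eq (Pmax : ℝ) {p : ℕ → ℝ}
    (hp : IsEqualProbabilityCodebook C.capLaw S.A p) :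
    ∃ G : ℂ × Vec S.L × V → ℝ, Measurable G ∧
      ∀ ω, C.etahat Pmax p ω = G (C.hp ω, C.hx ω, C.seed ω) := by
  classical
  obtain ⟨F, hF, hCF⟩ := C.exists_measurable_interferenceGain_eq
  let gain (d : ℂ × Vec S.L × V) : ℝ := ‖d.1‖ ^ 2
  let cap (d : ℂ × Vec S.L × V) : ℝ :=
    (gain d - S.gainThreshold) / (S.gainThreshold / S.sigma2 * F d.2)
  have hgain : Measurable gain := measurable_fst.norm.pow_const 2
  have hcap : Measurable cap :=
    (hgain.sub_const _).div ((hF.comp measurable_snd).const_mul _)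
  refine ⟨fun d => if S.gainThreshold ≤ gain d ∧ cap d < Pmax then codebookFloor S.A p (cap d)
    else Pmax, Measurable.ite ((measurableSet_le measurable_const hgain).inter
      (measurableSet_lt hcap measurable_const)) (hp.monotone_codebookFloor.measurable.comp hcap)
      measurable_const, fun ω => ?_⟩
  rw [etahat_eq, powerCap_eq, gainPenalty, hCF, noPrimaryOutage_eq]
  rfl

theorem measurable_etahat (Pmax : ℝ) {p : ℕ → ℝ}
    (hp : IsEqualProbabilityCodebook C.capLaw S.A p) : Measurable (C.etahat Pmax p) := by
  obtain ⟨G, hG, hCG⟩ := C.exists_measurable_etahat_eq Pmax hp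
  rw [funext hCG]
  exact hG.comp (C.measurable_hp_hx_seed)

variable [IsProbabilityMeasure μ]

theorem isProbabilityMeasure_map_gainPenalty : IsProbabilityMeasure (μ.map C.gainPenalty) :=
  Measure.isProbabilityMeasure_map C.measurable_gainPenalty.aemeasurable

theorem ae_map_gainPenalty_pos : ∀ᵐ w ∂(μ.map C.gainPenalty), 0 < w := by
  refine (ae_map_iff (by fun_prop) measurableSet_Ioi).2 ?_
  filter_upwards [C.ae_interferenceGain_pos] with ω hω
  exact mul_pos (div_pos S.gainThreshold_pos S.sigma2_pos) hω

theorem lintegral_map_gainPenalty :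
    ∫⁻ w, ENNReal.ofReal w ∂(μ.map C.gainPenalty) = ENNReal.ofReal S.meanGainPenalty := by
  have hc : 0 ≤ S.gainThreshold / S.sigma2 := (div_pos S.gainThreshold_pos S.sigma2_pos).le
  rw [lintegral_map (by fun_prop) (by fun_prop), Params.meanGainPenalty, ENNReal.ofReal_mul hc,
    ← C.lintegral_interferenceGain, ← lintegral_const_mul _ (by fun_prop)]
  simp only [gainPenalty, ENNReal.ofReal_mul hc]

/-- Given no primary outage, the excess of the exponential gain `g_p` over its threshold is again
exponential, so the power cap is a ratio of independent variables. -/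
theorem capLaw_eq :
    C.capLaw = ((expMeasure 1).prod (μ.map C.gainPenalty)).map fun z => z.1 / z.2 := by
  have joint := map_prodMk_cond_of_indepFun C.measurable_gp C.measurable_gainPenalty
    (C.indepFun_gp_interferenceGain.comp measurable_id (measurable_const_mul _))
    (measurableSet_Ici (a := S.gainThreshold))
  have := isProbabilityMeasure_expMeasure one_pos
  have := C.isProbabilityMeasure_map_gainPenalty
  rw [C.map_gp, ← C.noPrimaryOutage_eq] at joint
  rw [← map_sub_cond_expMeasure_Ici one_pos S.gainThreshold_pos.le]
  conv_rhs => rw [← Measure.map_id (μ := μ.map _)]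
  rw [Measure.map_prod_map _ _ (by fun_prop) measurable_id, ← joint,
    Measure.map_map (by fun_prop) (by fun_prop), Measure.map_map (by fun_prop) (by fun_prop),
    capLaw]
  exact congrArg (Measure.map · _) (funext C.powerCap_eq)

theorem measureReal_capLaw_Iic_le {t : ℝ} (ht : 0 ≤ t) :
    C.capLaw.real (Set.Iic t) ≤ S.meanGainPenalty * t := by
  have := C.isProbabilityMeasure_map_gainPenalty
  have h := map_div_expMeasure_prod_Iic_le one_pos C.ae_map_gainPenalty_pos ht
  rw [← C.capLaw_eq, one_mul, C.lintegral_map_gainPenalty, ← ENNReal.ofReal_mul ht, mul_comm] at h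
  exact ENNReal.toReal_le_of_le_ofReal (mul_nonneg S.meanGainPenalty_pos.le ht) h

theorem capLaw_Ioc_ne_zero {s t : ℝ} (hs : 0 ≤ s) (hst : s < t) :
    C.capLaw (Set.Ioc s t) ≠ 0 := by
  have := C.isProbabilityMeasure_map_gainPenalty
  rw [capLaw_eq]
  exact map_div_expMeasure_prod_Ioc_ne_zero one_pos C.ae_map_gainPenalty_pos hs hst

theorem measureReal_map_etahat_Iic_le {Pmax t : ℝ} {p : ℕ → ℝ}
    (hp : IsEqualProbabilityCodebook C.capLaw S.A p) (ht : 0 ≤ t) (htP : t < Pmax) :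
    (μ.map (C.etahat Pmax p)).real (Set.Iic t) ≤
      Real.exp (-S.gainThreshold) * (S.meanGainPenalty * t + 1 / (2 : ℝ) ^ S.A) := by
  classical
  have subset : C.etahat Pmax p ⁻¹' Set.Iic t ⊆
      C.noPrimaryOutage ∩ C.powerCap ⁻¹' {x | codebookFloor S.A p x ≤ t} := fun ω hω => by
    have hω' : C.etahat Pmax p ω ≤ t := hω
    rw [etahat_eq] at hω'
    split_ifs at hω' with hM
    · exact ⟨hM.1, hω'⟩
    · exact absurd hω' htP.not_ge
  have hfloor : MeasurableSet {x | codebookFloor S.A p x ≤ t} :=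
    hp.monotone_codebookFloor.measurable measurableSet_Iic
  calc (μ.map (C.etahat Pmax p)).real (Set.Iic t)
      = μ.real (C.etahat Pmax p ⁻¹' Set.Iic t) :=
        map_measureReal_apply (C.measurable_etahat Pmax hp) measurableSet_Iic
    _ ≤ μ.real (C.noPrimaryOutage ∩ C.powerCap ⁻¹' {x | codebookFloor S.A p x ≤ t}) :=
        measureReal_mono subset
    _ = Real.exp (-S.gainThreshold) * C.capLaw.real {x | codebookFloor S.A p x ≤ t} := by
        rw [capLaw, map_measureReal_apply C.measurable_powerCap hfloor, mul_comm,
          ← C.measureReal_noPrimaryOutage, measureReal_def, measureReal_def, measureReal_def,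
          ← ENNReal.toReal_mul, cond_mul_eq_inter C.measurableSet_noPrimaryOutage]
    _ ≤ _ := by
        gcongr
        exact (hp.measureReal_codebookFloor_le ht).trans
          (add_le_add_left (C.measureReal_capLaw_Iic_le ht) _)

end PowerControl

end Channel

namespace Params

variable (S : Params)

theorem ratio_eq (Pmax : ℝ) : S.ratio Pmax = S.thetaS * S.sigma2 / Pmax :=
  div_div_eq_mul_div _ _ _

theorem outageBound_eq (Pmax : ℝ) : S.outageBound Pmax =
    1 - incGamma ((S.L : ℝ) - 1) (S.ratio Pmax) / Real.Gamma ((S.L : ℝ) - 1)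
      + Real.exp (-S.gainThreshold) * S.meanGainPenalty * (S.thetaS * S.sigma2)
        * (incGamma ((S.L : ℝ) - 1 - 1) (S.ratio Pmax) / Real.Gamma ((S.L : ℝ) - 1))
      + Real.exp (-S.gainThreshold) * (1 / (2 : ℝ) ^ S.A)
        * (incGamma ((S.L : ℝ) - 1) (S.ratio Pmax) / Real.Gamma ((S.L : ℝ) - 1)) := by
  have := S.gammaP_pos.ne'
  have := S.sigma2_pos.ne'
  rw [outageBound, phi, alpha, Real.rpow_neg two_pos.le (S.A : ℝ), Real.rpow_natCast, one_div,
    sub_sub _ 1 1, one_add_one_eq_two, meanGainPenalty, gainThreshold, maxQuantError]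
  field_simp

end Params

namespace Channel

section Outage

variable {S : Params} {Ω : Type*} [MeasurableSpace Ω] {μ : Measure Ω}
  {V : Type*} [MeasurableSpace V] (C : Channel S μ V)

theorem outageProb_eq {Pmax : ℝ} (hP : 0 ≤ Pmax) {p : ℕ → ℝ}
    (hp : IsEqualProbabilityCodebook C.capLaw S.A p) {f : Ω → Vec S.L}
    (hf : ∀ᵐ ω ∂μ, IsOCBeamformer (C.sxhat ω) (C.ss ω) (C.etahat Pmax p ω) (f ω)) :
    outageProb C f =
      μ.real {ω | C.residualGain ω * C.etahat Pmax p ω ≤ S.thetaS * S.sigma2} := by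
  refine measureReal_congr ?_
  filter_upwards [hf, C.norm_quantizer] with ω hbeam (hunit : ‖C.sxhat ω‖ = 1)
  have received : C.gs ω * ‖inner ℂ (f ω) (C.ss ω)‖ ^ 2 =
      C.residualGain ω * C.etahat Pmax p ω := by
    rw [hbeam.norm_inner_sq (C.etahat_nonneg hP hp ω) hunit, residualGain,
      ← norm_sq_mul_shape (C.sxhat ω) (C.hs ω), gs, ss]
    ring
  refine propext ?_
  change C.gs ω / S.sigma2 * ‖inner ℂ (f ω) (C.ss ω)‖ ^ 2 ≤ S.thetaS ↔
    C.residualGain ω * C.etahat Pmax p ω ≤ S.thetaS * S.sigma2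
  rw [div_mul_eq_mul_div, div_le_iff₀ S.sigma2_pos, received]

variable [IsProbabilityMeasure μ]

/-- Projecting `h_s` off an independent unit vector leaves `L - 1` of its `L` complex dimensions. -/
theorem map_prodMk_residualGain :
    μ.map (fun ω => ((C.hp ω, C.hx ω, C.seed ω), C.residualGain ω)) =
      (μ.map fun ω => (C.hp ω, C.hx ω, C.seed ω)).prod (gammaMeasure ((S.L : ℝ) - 1) 1) := by
  have := isProbabilityMeasure_gammaMeasure S.L_sub_one_pos one_pos
  have := Measure.isProbabilityMeasure_map (μ := μ) C.measurable_hs.aemeasurable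
  have hD := C.measurable_hp_hx_seed
  have hq : Measurable fun d : ℂ × Vec S.L × V => C.quantizer (shape d.2.1, d.2.2) :=
    C.measurable_quantizer.comp (by fun_prop)
  have unit : ∀ᵐ d ∂(μ.map fun ω => (C.hp ω, C.hx ω, C.seed ω)),
      ‖C.quantizer (shape d.2.1, d.2.2)‖ = 1 :=
    (ae_map_iff hD.aemeasurable (measurableSet_eq_fun hq.norm measurable_const)).2 C.norm_quantizer
  refine map_prodMk_eq_prod_of_ae_map_eq (F := fun z : (ℂ × Vec S.L × V) × Vec S.L =>
      ‖z.2‖ ^ 2 - ‖inner ℂ (C.quantizer (shape z.1.2.1, z.1.2.2)) z.2‖ ^ 2)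
    hD C.measurable_hs ((measurable_snd.norm.pow_const 2).sub
      (((hq.comp measurable_fst).inner measurable_snd).norm.pow_const 2)) C.indep_hs.symm
    (unit.mono fun d hd => ?_)
  rw [(C.law_hs.isRadialGaussian one_pos C.measurable_hs).map_norm_sq_sub_norm_inner_sq one_pos
    (by rw [finrank_euclideanSpace_fin]; exact S.one_lt_L) hd, finrank_euclideanSpace_fin, inv_one]

theorem map_residualGain_prodMk_etahat (Pmax : ℝ) {p : ℕ → ℝ}
    (hp : IsEqualProbabilityCodebook C.capLaw S.A p) :
    μ.map (fun ω => (C.residualGain ω, C.etahat Pmax p ω)) =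
      (gammaMeasure ((S.L : ℝ) - 1) 1).prod (μ.map (C.etahat Pmax p)) := by
  obtain ⟨G, hG, hCG⟩ := C.exists_measurable_etahat_eq Pmax hp
  have := isProbabilityMeasure_gammaMeasure S.L_sub_one_pos one_pos
  have hD := C.measurable_hp_hx_seed
  have := Measure.isProbabilityMeasure_map (μ := μ) hD.aemeasurable
  calc μ.map (fun ω => (C.residualGain ω, C.etahat Pmax p ω))
      = (μ.map fun ω => ((C.hp ω, C.hx ω, C.seed ω), C.residualGain ω)).map
          (Prod.swap ∘ Prod.map G id) := by
        rw [Measure.map_map (by fun_prop) (by fun_prop)]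
        simp only [hCG]
        rfl
    _ = (gammaMeasure ((S.L : ℝ) - 1) 1).prod (μ.map (C.etahat Pmax p)) := by
        rw [C.map_prodMk_residualGain, ← Measure.map_map measurable_swap (by fun_prop),
          ← Measure.map_prod_map _ _ hG measurable_id, Measure.map_id, Measure.prod_swap,
          Measure.map_map hG hD, funext hCG]
        rfl

theorem ae_residualGain_pos : ∀ᵐ ω ∂μ, 0 < C.residualGain ω := by
  have := isProbabilityMeasure_gammaMeasure S.L_sub_one_pos one_pos
  have hD := C.measurable_hp_hx_seed
  have := Measure.isProbabilityMeasure_map (μ := μ) hD.aemeasurable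
  have law : μ.map C.residualGain = gammaMeasure ((S.L : ℝ) - 1) 1 := by
    have h := congrArg Measure.snd C.map_prodMk_residualGain
    rwa [Measure.snd_map_prodMk hD, Measure.snd_prod] at h
  exact ae_of_ae_map C.measurable_residualGain.aemeasurable
    (law ▸ ae_pos_gammaMeasure ((S.L : ℝ) - 1) 1)

theorem outageProb_le_outageBound {Pmax : ℝ} (hP : 0 < Pmax) {p : ℕ → ℝ}
    (hp : IsEqualProbabilityCodebook C.capLaw S.A p) {f : Ω → Vec S.L}
    (hf : ∀ᵐ ω ∂μ, IsOCBeamformer (C.sxhat ω) (C.ss ω) (C.etahat Pmax p ω) (f ω)) :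
    outageProb C f ≤ S.outageBound Pmax := by
  have hη := C.measurable_etahat Pmax hp
  have := Measure.isProbabilityMeasure_map (μ := μ) hη.aemeasurable
  have hset : MeasurableSet {z : ℝ × ℝ | z.1 * z.2 ≤ S.thetaS * S.sigma2} :=
    measurableSet_le (by fun_prop) measurable_const
  calc outageProb C f
      = ((gammaMeasure ((S.L : ℝ) - 1) 1).prod (μ.map (C.etahat Pmax p))).real
          {z | z.1 * z.2 ≤ S.thetaS * S.sigma2} := by
        rw [C.outageProb_eq hP.le hp hf, ← C.map_residualGain_prodMk_etahat Pmax hp,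
          map_measureReal_apply (by fun_prop) hset]
        rfl
    _ ≤ S.outageBound Pmax := by
        rw [S.outageBound_eq, S.ratio_eq]
        refine measureReal_gammaMeasure_prod_mul_le S.L_sub_one_pos
          (mul_pos S.thetaS_pos S.sigma2_pos).le hP fun t ht htP => ?_
        rw [mul_assoc, ← mul_add]
        exact C.measureReal_map_etahat_Iic_le hp ht htP

/-- For large `Pmax` a primary outage leaves enough power to avoid a secondary outage, and otherwise
the IPC signal is the rounded power cap. -/
theorem tendsto_measureReal_residualGain_mul_etahat_le {p : ℕ → ℝ}
    (hp : IsEqualProbabilityCodebook C.capLaw S.A p) (x : ℝ) :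
    Tendsto (fun Pmax => μ.real {ω | C.residualGain ω * C.etahat Pmax p ω ≤ x}) atTop
      (𝓝 (μ.real (C.noPrimaryOutage ∩
        {ω | C.residualGain ω * codebookFloor S.A p (C.powerCap ω) ≤ x}))) := by
  classical
  have hfloor : Measurable fun ω => codebookFloor S.A p (C.powerCap ω) :=
    hp.monotone_codebookFloor.measurable.comp C.measurable_powerCap
  refine (ENNReal.tendsto_toReal (measure_ne_top μ _)).comp
    (tendsto_measure_of_ae_tendsto_indicator_of_isFiniteMeasure atTop
      (C.measurableSet_noPrimaryOutage.inter
        (measurableSet_le (C.measurable_residualGain.mul hfloor) measurable_const))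
      (fun Pmax => measurableSet_le
        (C.measurable_residualGain.mul (C.measurable_etahat Pmax hp)) measurable_const) ?_)
  filter_upwards [C.ae_residualGain_pos] with ω hR
  by_cases hM : ω ∈ C.noPrimaryOutage
  · filter_upwards [eventually_gt_atTop (C.powerCap ω)] with Pmax hPmax
    change C.residualGain ω * C.etahat Pmax p ω ≤ x ↔ ω ∈ C.noPrimaryOutage ∧ _
    rw [etahat_eq, if_pos ⟨hM, hPmax⟩]
    exact (and_iff_right hM).symm
  · filter_upwards [eventually_gt_atTop (x / C.residualGain ω)] with Pmax hPmax
    change C.residualGain ω * C.etahat Pmax p ω ≤ x ↔ ω ∈ C.noPrimaryOutage ∧ _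
    rw [etahat_eq, if_neg (not_and_of_not_left _ hM)]
    exact iff_of_false ((div_lt_iff₀' hR).1 hPmax).not_ge (not_and_of_not_left _ hM)

theorem tendsto_outageProb {p : ℝ → ℕ → ℝ} {p₀ : ℕ → ℝ}
    (hp : ∀ Pmax, 0 < Pmax → IsEqualProbabilityCodebook C.capLaw S.A (p Pmax))
    (hp₀ : IsEqualProbabilityCodebook C.capLaw S.A p₀) {f : ℝ → Ω → Vec S.L}
    (hf : ∀ Pmax, 0 < Pmax → ∀ᵐ ω ∂μ,
      IsOCBeamformer (C.sxhat ω) (C.ss ω) (C.etahat Pmax (p Pmax) ω) (f Pmax ω)) :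
    Tendsto (fun Pmax => outageProb C (f Pmax)) atTop
      (𝓝 (μ.real (C.noPrimaryOutage ∩
        {ω | C.residualGain ω * codebookFloor S.A p₀ (C.powerCap ω) ≤ S.thetaS * S.sigma2}))) := by
  refine (C.tendsto_measureReal_residualGain_mul_etahat_le hp₀ _).congr' ?_
  filter_upwards [eventually_gt_atTop 0] with Pmax hPmax
  have floor_eq : codebookFloor S.A p₀ = codebookFloor S.A (p Pmax) :=
    codebookFloor_congr fun _ =>
      hp₀.eq_of_forall_Ioc_ne_zero (hp Pmax hPmax) fun _ _ => C.capLaw_Ioc_ne_zero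
  rw [C.outageProb_eq hPmax.le (hp Pmax hPmax) (hf Pmax hPmax)]
  simp only [etahat, floor_eq]

end Outage

end Channel

namespace Params

variable (S : Params)

theorem tendsto_ratio : Tendsto S.ratio atTop (𝓝 0) :=
  (tendsto_id.atTop_div_const S.sigma2_pos).const_div_atTop S.thetaS

theorem tendsto_incGamma_ratio {a : ℝ} (ha : 0 < a) :
    Tendsto (fun Pmax => incGamma a (S.ratio Pmax)) atTop (𝓝 (Real.Gamma a)) := by
  refine tendsto_incGamma ha S.tendsto_ratio ?_
  filter_upwards [eventually_ge_atTop 0] with Pmax hPmax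
  exact div_nonneg S.thetaS_pos.le (div_nonneg hPmax S.sigma2_pos.le)

theorem tendsto_incGamma_ratio_div_Gamma :
    Tendsto (fun Pmax => incGamma ((S.L : ℝ) - 1) (S.ratio Pmax) / Real.Gamma ((S.L : ℝ) - 1))
      atTop (𝓝 1) := by
  have h := (S.tendsto_incGamma_ratio S.L_sub_one_pos).div_const (Real.Gamma ((S.L : ℝ) - 1))
  rwa [div_self (Real.Gamma_pos_of_pos S.L_sub_one_pos).ne'] at h

theorem tendsto_alpha : Tendsto S.alpha atTop (𝓝 S.alpha') := by
  rw [alpha', ← mul_one (Real.exp _)]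
  exact S.tendsto_incGamma_ratio_div_Gamma.const_mul _

theorem tendsto_phi (hL : 3 ≤ S.L) : Tendsto S.phi atTop (𝓝 S.phi') := by
  have hL₂ : (0 : ℝ) < (S.L : ℝ) - 2 := sub_pos.2 (Nat.ofNat_lt_cast.2 hL)
  have Gamma_L_sub_one : Real.Gamma ((S.L : ℝ) - 1) = (S.L - 2) * Real.Gamma (S.L - 2) := by
    rw [← Real.Gamma_add_one hL₂.ne']
    ring_nf
  have phi'_eq : S.phi' = Real.exp (-(S.thetaP / S.gammaP)) *
      (((S.L : ℝ) - 1) * S.lam * S.thetaP * S.thetaS * Real.Gamma ((S.L : ℝ) - 2) /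
        (S.gammaP * Real.Gamma ((S.L : ℝ) - 1))) := by
    have := (Real.Gamma_pos_of_pos hL₂).ne'
    rw [Gamma_L_sub_one, phi']
    field_simp
  rw [phi'_eq]
  exact (((S.tendsto_incGamma_ratio hL₂).const_mul _).div_const _).const_mul _

theorem tendsto_outageBound (hL : 3 ≤ S.L) : Tendsto S.outageBound atTop (𝓝 S.limitBound) := by
  have h := ((S.tendsto_incGamma_ratio_div_Gamma.const_sub 1).add
    ((S.tendsto_phi hL).mul_const ((2 : ℝ) ^ (-((S.B : ℝ) / ((S.L : ℝ) - 1)))))).add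
      (S.tendsto_alpha.mul_const ((2 : ℝ) ^ (-(S.A : ℝ))))
  rwa [sub_self, zero_add] at h

end Params

end CognitiveBeamforming

end

theorem mainTheorem6 (S : CognitiveBeamforming.Params) (hL : 3 ≤ S.L)
    {Ω V : Type*} [MeasurableSpace Ω] [MeasurableSpace V]
    (μ : Measure Ω) [IsProbabilityMeasure μ]
    (C : CognitiveBeamforming.Channel S μ V)
    (p : ℝ → ℕ → ℝ) (hp : ∀ Pmax : ℝ, 0 < Pmax → C.IsCodebook Pmax (p Pmax))
    (f : ℝ → Ω → CognitiveBeamforming.Vec S.L)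
    (hf : ∀ Pmax : ℝ, 0 < Pmax → ∀ᵐ ω ∂μ,
      CognitiveBeamforming.IsOCBeamformer (C.sxhat ω) (C.ss ω) (C.etahat Pmax (p Pmax) ω)
        (f Pmax ω)) :
    (∀ Pmax : ℝ, 0 < Pmax →
      CognitiveBeamforming.outageProb C (f Pmax) ≤ S.outageBound Pmax) ∧
    Tendsto S.outageBound atTop (𝓝 S.limitBound) ∧
    ∃ ℓ : ℝ, Tendsto (fun Pmax => CognitiveBeamforming.outageProb C (f Pmax)) atTop (𝓝 ℓ) ∧
      ℓ ≤ S.limitBound := by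
  have hcode : ∀ Pmax, 0 < Pmax →
      CognitiveBeamforming.IsEqualProbabilityCodebook C.capLaw S.A (p Pmax) :=
    fun Pmax hPmax => (hp Pmax hPmax).isEqualProbabilityCodebook
  have bound : ∀ Pmax, 0 < Pmax →
      CognitiveBeamforming.outageProb C (f Pmax) ≤ S.outageBound Pmax :=
    fun Pmax hPmax => C.outageProb_le_outageBound hPmax (hcode Pmax hPmax) (hf Pmax hPmax)
  have bound_tendsto := S.tendsto_outageBound hL
  have outage_tendsto := C.tendsto_outageProb hcode (hcode 1 one_pos) hf
  exact ⟨bound, bound_tendsto, _, outage_tendsto, le_of_tendsto_of_tendsto outage_tendsto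
    bound_tendsto ((eventually_gt_atTop 0).mono bound)⟩
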